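/- Notation. Fix $c\in\mathbb C^\times$ and $m,n\ge 0$. Let $\mathbb C^{m|n}$ have basis vectors $1,\dots,m$ even ($[i]=0$) and $m+1,\dots,m+n$ odd ($[i]=1$), let $E_{ij}$ be the elementary matrices (of parity $[i]+[j]$), and $\mathrm{str}\,E_{ij}=(-1)^{[j]}\delta_{ij}$. Put $g(u,v)=\frac{c}{u-v}$, $f=1+g$, $h=f/g=\frac{u-v+c}{c}$. The super-Yangian $Y(m|n)$ is the unital associative superalgebra over $\mathbb C$ generated by $T_{ij}^{(p)}$, $p\ge 0$, of parity $[i]+[j]$, with $T_{ij}(u)=\delta_{ij}+\sum_{p\ge0}T_{ij}^{(p)}(c/u)^{p+1}$ and relations $$T_{ij}(z)T_{kl}(w)-(-1)^{([i]+[j])([k]+[l])}T_{kl}(w)T_{ij}(z)=(-1)^{[l]([i]+[j])+[i][j]}g(z,w)\big(T_{il}(z)T_{kj}(w)-T_{il}(w)T_{kj}(z)\big).$$ Let $\psi$ be the linear map of $Y(m|n)$ with $\psi(1)=1$, $\psi(T_{ij}(u))=(-1)^{[i][j]+[i]}T_{ji}(u)$ and $\psi(AB)=(-1)^{[A][B]}\psi(B)\psi(A)$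 for homogeneous $A,B$. Let $V$ be a $\mathbb Z_2$-graded $Y(m|n)$-module generated by an even vector $\Omega$ with $T_{ii}(u)\Omega=\lambda_i(u)\Omega$, where $\lambda_i(u)=1+\sum_{p\ge0}\lambda_i^{(p)}(c/u)^{p+1}$, and $T_{ij}(u)\Omega=0$ for $i>j$. Its dual is the right module $V^\dagger=Y(m|n)/\psi(\mathrm{Ann}\,\Omega)$, with $\psi:V\to V^\dagger$, $y\,\Omega\mapsto[\psi(y)]$, and $\Omega^\dagger=\psi(\Omega)$, so that $\psi(y\,\Omega)=\Omega^\dagger\psi(y)$. Let $a,b\ge0$, and let $\bar u=(u_1,\dots,u_a)$ and $\bar v=(v_1,\dots,v_b)$ be independent formal parameters: vectors are formal power series in the $u_i^{-1},v_j^{-1}$, rational functions of the parameters are allowed as scalars, and $\psi$ acts on coefficients. For a tuple $\bar w=(w_1,\dots,w_\ell)$ put $\bar w^*=(w_\ell,\dots,w_1)$ and $H(\bar w)=\prod_{k<j}h(w_j,w_k)$. In the graded tensor product $\mathrm{End}(\mathbb C^{m|n})^{\otimes(a+b)}\otimes Y(m|n)$ let $E_{ij}^{(r)}$ be $E_{ij}$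 in the $r$-th copy, $T_r(u)=\sum_{i,j}E_{ij}^{(r)}\otimes T_{ij}(u)$, $P_{rs}=\sum_{i,j}(-1)^{[j]}E_{ij}^{(r)}E_{ji}^{(s)}$, $$\mathbb R=(R_{a+1,a}\cdots R_{a+1,1})(R_{a+2,a}\cdots R_{a+2,1})\cdots(R_{a+b,a}\cdots R_{a+b,1}),\qquad R_{a+j,k}=1+g(v_j,u_k)P_{a+j,k}.$$ Let $\mathrm{str}$ be the super-trace over all $a+b$ copies and put $\mathbb T=T_1(u_1)\cdots T_a(u_a)T_{a+1}(v_1)\cdots T_{a+b}(v_b)$. The Bethe vectors are $$\Phi_{ab}(\bar u,\bar v)=N\;\mathrm{str}\big[\mathbb T\,\mathbb R\,E_{21}^{(1)}\cdots E_{21}^{(a)}E_{32}^{(a+1)}\cdots E_{32}^{(a+b)}\big]\Omega,$$ with $N=\frac{(-1)^b}{H(\bar v)}$ for $Y(2|1)$ and $N=\frac{(-1)^a}{H(\bar u)}$ for $Y(1|2)$; the dual Bethe vectors are $\Psi_{ab}(\bar u,\bar v)=\psi\big(\Phi_{ab}(\bar u^*,\bar v^*)\big)$. Proposition. For $Y(2|1)$,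 $$\Psi_{ab}(\bar u,\bar v)=\frac{(-1)^{b(b-1)/2}}{H(\bar v^*)}\,\Omega^\dagger\,\mathrm{str}\big[\mathbb T\,\mathbb R\,E_{12}^{(1)}\cdots E_{12}^{(a)}E_{23}^{(a+1)}\cdots E_{23}^{(a+b)}\big],\qquad H(\bar v^*)=\prod_{1\le j<k\le b}h(v_j,v_k),$$ and for $Y(1|2)$, $$\Psi_{ab}(\bar u,\bar v)=\frac{(-1)^{a(a-1)/2}}{H(\bar u^*)}\,\Omega^\dagger\,\mathrm{str}\big[\mathbb T\,\mathbb R\,E_{12}^{(1)}\cdots E_{12}^{(a)}E_{23}^{(a+1)}\cdots E_{23}^{(a+b)}\big],\qquad H(\bar u^*)=\prod_{1\le j<k\le a}h(u_j,u_k).$$ -/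

import Mathlib

open scoped TensorProduct

noncomputable section

namespace SuperYangian

/-! ### Parities and signs -/

/-- The sign `(-1)^x` of a parity `x ∈ ℤ/2ℤ`. -/
def sgn (x : ZMod 2) : ℤ := if x = 0 then 1 else -1

theorem sgn_add (x y : ZMod 2) : sgn (x + y) = sgn x * sgn y := by
  revert x y; decide

theorem parity_cases (x : ZMod 2) : x = 0 ∨ x = 1 := by
  revert x; decide

/-- The distinguished gradation of `{1, …, m+n}`: the first `m` indices are even, the last `n`
ones are odd (indices are numbered from `0` in the code). -/
def par (m n : ℕ) (i : Fin (m + n)) : ZMod 2 := if (i : ℕ) < m then 0 else 1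

/-! ### The super-Yangian `Y(m|n)` -/

/-- The free algebra on the symbols `T_{ij}^{(p)}`, `p ≥ 0`. -/
abbrev FreeGen (m n : ℕ) : Type := FreeAlgebra ℂ (Fin (m + n) × Fin (m + n) × ℕ)

/-- The coefficient of `(c/u)^r` in the series
`T_{ij}(u) = δ_{ij} + ∑_{p ≥ 0} T_{ij}^{(p)} (c/u)^{p+1}`, in the free algebra. -/
def freeMode (m n : ℕ) (i j : Fin (m + n)) : ℕ → FreeGen m n
  | 0 => if i = j then 1 else 0
  | p + 1 => FreeAlgebra.ι ℂ (i, j, p)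

/-- The defining relations of `Y(m|n)`: the coefficients of `(c/z)^r (c/w)^s` in
`((z-w)/c) [T_{ij}(z), T_{kl}(w)}
  = (-1)^{[l]([i]+[j])+[i][j]} (T_{il}(z) T_{kj}(w) - T_{il}(w) T_{kj}(z))`,
where `[A, B} = A B - (-1)^{[A][B]} B A` is the graded commutator. These are the components of
the `RTT` relation. -/
inductive Rel (m n : ℕ) : FreeGen m n → FreeGen m n → Prop
  | rtt (i j k l : Fin (m + n)) (r s : ℕ) : Rel m n
      ((freeMode m n i j (r + 1) * freeMode m n k l s
          - sgn ((par m n i + par m n j) * (par m n k + par m n l)) •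
            (freeMode m n k l s * freeMode m n i j (r + 1)))
        - (freeMode m n i j r * freeMode m n k l (s + 1)
          - sgn ((par m n i + par m n j) * (par m n k + par m n l)) •
            (freeMode m n k l (s + 1) * freeMode m n i j r)))
      (sgn (par m n l * (par m n i + par m n j) + par m n i * par m n j) •
        (freeMode m n i l r * freeMode m n k j s - freeMode m n i l s * freeMode m n k j r))

/-- The super-Yangian `Y(m|n)`. -/
def Yangian (m n : ℕ) : Type := RingQuot (Rel m n)

instance (m n : ℕ) : Ring (Yangian m n) := inferInstanceAs (Ring (RingQuot (Rel m n)))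

instance (m n : ℕ) : Algebra ℂ (Yangian m n) :=
  inferInstanceAs (Algebra ℂ (RingQuot (Rel m n)))

/-- The projection of the free algebra onto `Y(m|n)`. -/
def proj (m n : ℕ) : FreeGen m n →ₐ[ℂ] Yangian m n := RingQuot.mkAlgHom ℂ (Rel m n)

/-- The coefficient of `(c/u)^r` in `T_{ij}(u)`, as an element of `Y(m|n)`:
`δ_{ij}` for `r = 0`, and the generator `T_{ij}^{(r-1)}` for `r ≥ 1`. -/
def mode (m n : ℕ) (i j : Fin (m + n)) (r : ℕ) : Yangian m n := proj m n (freeMode m n i j r)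

theorem mode_zero (m n : ℕ) (i j : Fin (m + n)) :
    mode m n i j 0 = if i = j then 1 else 0 := by
  unfold mode freeMode
  split_ifs <;> simp

theorem proj_rel {m n : ℕ} {x y : FreeGen m n} (h : Rel m n x y) : proj m n x = proj m n y :=
  RingQuot.mkAlgHom_rel ℂ h

theorem mode_rel (m n : ℕ) (i j k l : Fin (m + n)) (r s : ℕ) :
    (mode m n i j (r + 1) * mode m n k l s
          - sgn ((par m n i + par m n j) * (par m n k + par m n l)) •
            (mode m n k l s * mode m n i j (r + 1)))
        - (mode m n i j r * mode m n k l (s + 1)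
          - sgn ((par m n i + par m n j) * (par m n k + par m n l)) •
            (mode m n k l (s + 1) * mode m n i j r))
      = sgn (par m n l * (par m n i + par m n j) + par m n i * par m n j) •
        (mode m n i l r * mode m n k j s - mode m n i l s * mode m n k j r) := by
  have h := proj_rel (Rel.rtt (m := m) (n := n) i j k l r s)
  simp only [map_sub, map_mul, map_zsmul] at h
  exact h

/-- Algebra maps out of `Y(m|n)`. -/
def lift {m n : ℕ} {A : Type*} [Ring A] [Algebra ℂ A] (f : FreeGen m n →ₐ[ℂ] A)
    (hf : ∀ ⦃x y⦄, Rel m n x y → f x = f y) : Yangian m n →ₐ[ℂ] A :=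
  RingQuot.liftAlgHom ℂ ⟨f, hf⟩

theorem lift_mode {m n : ℕ} {A : Type*} [Ring A] [Algebra ℂ A] (f : FreeGen m n →ₐ[ℂ] A)
    (hf : ∀ ⦃x y⦄, Rel m n x y → f x = f y) (i j : Fin (m + n)) (r : ℕ) :
    lift f hf (mode m n i j r) = f (freeMode m n i j r) :=
  RingQuot.liftAlgHom_mkAlgHom_apply ℂ f hf _

theorem algHom_ext {m n : ℕ} {A : Type*} [Ring A] [Algebra ℂ A] {f g : Yangian m n →ₐ[ℂ] A}
    (h : ∀ i j r, f (mode m n i j r) = g (mode m n i j r)) : f = g := by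
  apply RingQuot.ringQuot_ext'
  apply FreeAlgebra.hom_ext
  funext x
  exact h x.1 x.2.1 (x.2.2 + 1)

/-! ### The grading and the transposition antimorphism of `Y(m|n)` -/

def grFree (m n : ℕ) : FreeGen m n →ₐ[ℂ] Yangian m n :=
  FreeAlgebra.lift ℂ fun x => sgn (par m n x.1 + par m n x.2.1) • mode m n x.1 x.2.1 (x.2.2 + 1)

theorem grFree_mode (m n : ℕ) (i j : Fin (m + n)) (r : ℕ) :
    grFree m n (freeMode m n i j r) = sgn (par m n i + par m n j) • mode m n i j r := by
  cases r with
  | zero =>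
    rw [mode_zero]
    by_cases h : i = j
    · subst h
      have : par m n i + par m n i = 0 := CharTwo.add_self_eq_zero _
      simp [freeMode, this, sgn]
    · simp [freeMode, h]
  | succ p => simp [freeMode, grFree]

/-- The grading automorphism `gr` of `Y(m|n)`: `T_{ij}(u) ↦ (-1)^{[i]+[j]} T_{ij}(u)`. An element
`A` is homogeneous of parity `x` iff `gr A = (-1)^x A`. -/
def gr (m n : ℕ) : Yangian m n →ₐ[ℂ] Yangian m n :=
  lift (grFree m n) (by
    rintro _ _ ⟨i, j, k, l, r, s⟩
    have h := mode_rel m n i j k l r s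
    simp only [map_sub, map_mul, map_zsmul, grFree_mode, smul_mul_smul_comm]
    have e1 : sgn (par m n i + par m n j) * sgn (par m n k + par m n l)
        = sgn (par m n i + par m n l) * sgn (par m n k + par m n j) := by
      simp only [sgn_add]; ring
    rw [mul_comm (sgn (par m n k + par m n l)), ← e1]
    simp only [← smul_sub, smul_comm (sgn (_ * _)) (sgn _ * sgn _)]
    rw [smul_comm (sgn (_ * _ + _)), h])

theorem gr_mode (m n : ℕ) (i j : Fin (m + n)) (r : ℕ) :
    gr m n (mode m n i j r) = sgn (par m n i + par m n j) • mode m n i j r := by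
  rw [gr, lift_mode, grFree_mode]

theorem sgn_smul_sgn_smul {M : Type*} [AddCommGroup M] (x : ZMod 2) (y : M) :
    sgn x • sgn x • y = y := by
  rw [smul_smul, ← sgn_add, CharTwo.add_self_eq_zero]; simp [sgn]

theorem gr_gr (m n : ℕ) (y : Yangian m n) : gr m n (gr m n y) = y := by
  have : (gr m n).comp (gr m n) = AlgHom.id ℂ _ := by
    apply algHom_ext
    intro i j r
    simp only [AlgHom.comp_apply, gr_mode, map_zsmul, sgn_smul_sgn_smul, AlgHom.id_apply]
  exact DFunLike.congr_fun this y

/-- `i^x` for a parity `x`. Since `i^x i^y = (-1)^{xy} i^{x+y}` for parities, multiplying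
homogeneous elements by these factors turns graded antimorphisms into ordinary ones. -/
def quarter (x : ZMod 2) : ℂ := if x = 0 then 1 else Complex.I

def chiCoef (m n : ℕ) (i j : Fin (m + n)) : ℂ :=
  quarter (par m n i + par m n j) * (sgn (par m n i * par m n j + par m n i) : ℂ)

def chiFree (m n : ℕ) : FreeGen m n →ₐ[ℂ] (Yangian m n)ᵐᵒᵖ :=
  FreeAlgebra.lift ℂ fun x =>
    MulOpposite.op (chiCoef m n x.1 x.2.1 • mode m n x.2.1 x.1 (x.2.2 + 1))

theorem chiFree_mode (m n : ℕ) (i j : Fin (m + n)) (r : ℕ) :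
    chiFree m n (freeMode m n i j r) = MulOpposite.op (chiCoef m n i j • mode m n j i r) := by
  cases r with
  | zero =>
    rw [mode_zero]
    by_cases h : i = j
    · subst h
      have : par m n i + par m n i = 0 := CharTwo.add_self_eq_zero _
      have h2 : sgn (par m n i * par m n i + par m n i) = 1 := by
        generalize par m n i = x
        revert x; decide
      simp [freeMode, chiCoef, quarter, this, h2]
    · simp [freeMode, h, Ne.symm h]
  | succ p => simp [freeMode, chiFree]

theorem chi_sign (a b c d : ZMod 2) :
    (-(sgn ((a + b) * (c + d)) * sgn (c * (b + a) + b * a)) : ℂ) *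
        ((quarter (a + b) * sgn (a * b + a)) * (quarter (c + d) * sgn (c * d + c)))
      = -(sgn (d * (a + b) + a * b) : ℂ) *
        ((quarter (a + d) * sgn (a * d + a)) * (quarter (c + b) * sgn (c * b + c))) := by
  have h2 : (1 + 1 : ZMod 2) = 0 := by decide
  rcases parity_cases a with rfl | rfl <;> rcases parity_cases b with rfl | rfl <;>
    rcases parity_cases c with rfl | rfl <;> rcases parity_cases d with rfl | rfl <;>
    simp [sgn, quarter, h2]

/-- The ordinary antimorphism of `Y(m|n)` equal to `i^x ψ` on homogeneous elements of parity `x`,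
where `ψ` is the transposition antimorphism. -/
def chi (m n : ℕ) : Yangian m n →ₐ[ℂ] (Yangian m n)ᵐᵒᵖ :=
  lift (chiFree m n) (by
    rintro _ _ ⟨i, j, k, l, r, s⟩
    have h := mode_rel m n j i l k r s
    have e := chi_sign (par m n i) (par m n j) (par m n k) (par m n l)
    simp only [map_sub, map_mul, map_zsmul, chiFree_mode]
    apply MulOpposite.unop_injective
    simp only [MulOpposite.unop_sub, MulOpposite.unop_smul, MulOpposite.unop_mul,
      MulOpposite.unop_op, smul_mul_smul_comm, chiCoef]
    generalize quarter (par m n i + par m n j) * _ = C₁ at e ⊢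
    generalize quarter (par m n k + par m n l) * _ = C₂ at e ⊢
    generalize quarter (par m n i + par m n l) * _ = C₃ at e ⊢
    generalize quarter (par m n k + par m n j) * _ = C₄ at e ⊢
    have hσ : (sgn ((par m n i + par m n j) * (par m n k + par m n l)) : ℂ)
        * sgn ((par m n i + par m n j) * (par m n k + par m n l)) = 1 := by
      rw [← Int.cast_mul, ← sgn_add, CharTwo.add_self_eq_zero]; simp [sgn]
    rw [add_comm (par m n j) (par m n i), add_comm (par m n l) (par m n k)] at h
    rw [add_comm (par m n j) (par m n i)] at e
    simp only [← Int.cast_smul_eq_zsmul ℂ] at h ⊢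
    generalize (sgn ((par m n i + par m n j) * (par m n k + par m n l)) : ℂ) = σ at e h hσ ⊢
    generalize (sgn (par m n l * (par m n i + par m n j) + par m n i * par m n j) : ℂ) = τ at e ⊢
    generalize (sgn (par m n k * (par m n i + par m n j) + par m n j * par m n i) : ℂ) = ρ at e h
    have h2 := congrArg (fun y => (-σ * (C₁ * C₂)) • y) h
    simp only [smul_smul] at h2
    rw [show -σ * (C₁ * C₂) * ρ = -τ * (C₃ * C₄) by rw [← e]; ring] at h2
    refine Eq.trans ?_ (h2.trans ?_)
    · have hσ' : C₁ * C₂ = σ * σ * (C₁ * C₂) := by rw [hσ, one_mul]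
      rw [mul_comm C₂ C₁, smul_sub, smul_sub, smul_sub, smul_smul, smul_smul, smul_smul, smul_smul]
      conv_lhs => 
        enter [1, 1, 1]
        rw [hσ']
      conv_lhs => 
        enter [2, 1, 1]
        rw [hσ']
      module
    · module)

theorem chi_mode (m n : ℕ) (i j : Fin (m + n)) (r : ℕ) :
    chi m n (mode m n i j r) = MulOpposite.op (chiCoef m n i j • mode m n j i r) := by
  rw [chi, lift_mode, chiFree_mode]

/-- `chi` as a linear endomorphism of `Y(m|n)`. -/
def chiLin (m n : ℕ) : Yangian m n →ₗ[ℂ] Yangian m n :=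
  (MulOpposite.opLinearEquiv ℂ).symm.toLinearMap ∘ₗ (chi m n).toLinearMap

/-- The transposition antimorphism `ψ` of `Y(m|n)`; it is the unique linear map with
`ψ 1 = 1`, `ψ (T_{ij}(u)) = (-1)^{[i][j]+[i]} T_{ji}(u)` and `ψ (A B) = (-1)^{[A][B]} ψ B ψ A` for
homogeneous `A`, `B`; see `transpose_one`, `transpose_mode` and `transpose_mul` below. -/
def transpose (m n : ℕ) : Yangian m n →ₗ[ℂ] Yangian m n :=
  chiLin m n ∘ₗ ((1 / 2 : ℂ) • (LinearMap.id + (gr m n).toLinearMap))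
    - Complex.I • (chiLin m n ∘ₗ ((1 / 2 : ℂ) • (LinearMap.id - (gr m n).toLinearMap)))

theorem transpose_of_homogeneous (m n : ℕ) (x : ZMod 2) (y : Yangian m n)
    (hy : gr m n y = sgn x • y) :
    transpose m n y = (quarter x)⁻¹ • (chi m n y).unop := by
  have e : ∀ z, chiLin m n z = (chi m n z).unop := fun _ => rfl
  have a : (2⁻¹ : ℂ) • (y + y) = y := by module
  rcases parity_cases x with rfl | rfl
  · have hy' : gr m n y = y := by simpa [sgn] using hy
    simp [transpose, e, hy', quarter, a, -smul_add]
  · have hy' : gr m n y = -y := by simpa [sgn] using hy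
    simp [transpose, e, hy', quarter, a, -smul_add]

theorem transpose_one (m n : ℕ) : transpose m n 1 = 1 := by
  rw [transpose_of_homogeneous m n 0 1 (by simp [sgn])]
  simp [quarter]

theorem quarter_ne_zero (x : ZMod 2) : quarter x ≠ 0 := by
  unfold quarter; split_ifs <;> simp

theorem transpose_mode (m n : ℕ) (i j : Fin (m + n)) (r : ℕ) :
    transpose m n (mode m n i j r)
      = sgn (par m n i * par m n j + par m n i) • mode m n j i r := by
  rw [transpose_of_homogeneous m n _ _ (gr_mode m n i j r), chi_mode, MulOpposite.unop_op,
    smul_smul, chiCoef, ← mul_assoc, inv_mul_cancel₀ (quarter_ne_zero _), one_mul,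
    Int.cast_smul_eq_zsmul]

theorem transpose_mul (m n : ℕ) (x y : ZMod 2) (A B : Yangian m n)
    (hA : gr m n A = sgn x • A) (hB : gr m n B = sgn y • B) :
    transpose m n (A * B) = sgn (x * y) • (transpose m n B * transpose m n A) := by
  have hAB : gr m n (A * B) = sgn (x + y) • (A * B) := by
    rw [map_mul, hA, hB, smul_mul_smul_comm, sgn_add]
  rw [transpose_of_homogeneous m n _ _ hA, transpose_of_homogeneous m n _ _ hB,
    transpose_of_homogeneous m n _ _ hAB, map_mul, MulOpposite.unop_mul, smul_mul_smul_comm,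
    ← Int.cast_smul_eq_zsmul ℂ, smul_smul]
  congr 1
  have h2 : (1 + 1 : ZMod 2) = 0 := by decide
  rcases parity_cases x with rfl | rfl <;> rcases parity_cases y with rfl | rfl <;>
    simp [sgn, quarter, h2]

/-! ### The graded tensor algebra `End(ℂ^{m|n})^{⊗ N} ⊗ A` -/

/-- A superalgebra `A`, given through its grading automorphism (`+1` on even elements, `-1` on odd
elements). -/
class ParityRing (A : Type*) [Ring A] where
  gr : A →+* A
  gr_gr : ∀ y, gr (gr y) = y

/-- `(gr)^x` for a parity `x`. -/
def grPow {A : Type*} [Ring A] [ParityRing A] (x : ZMod 2) : A →+* A :=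
  if x = 0 then RingHom.id A else ParityRing.gr

theorem grPow_zero {A : Type*} [Ring A] [ParityRing A] (y : A) : grPow 0 y = y := by
  simp [grPow]

theorem grPow_add {A : Type*} [Ring A] [ParityRing A] (x x' : ZMod 2) (y : A) :
    grPow (x + x') y = grPow x (grPow x' y) := by
  have h2 : (1 + 1 : ZMod 2) = 0 := by decide
  rcases parity_cases x with rfl | rfl <;> rcases parity_cases x' with rfl | rfl <;>
    simp [grPow, h2, ParityRing.gr_gr]

/-- The graded tensor product `End(ℂ^{m|n})^{⊗ N} ⊗ A` (in this order), where `p` is the gradation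
of the basis of `ℂ^{m|n}`. The array `M` represents
`∑_{I,J} E_{i_1 j_1} ⊗ ⋯ ⊗ E_{i_N j_N} ⊗ M_{I J}`. -/
def AuxMat {d : ℕ} (_p : Fin d → ZMod 2) (N : ℕ) (A : Type*) : Type _ :=
  (Fin N → Fin d) → (Fin N → Fin d) → A

namespace AuxMat

variable {d : ℕ} {p : Fin d → ZMod 2} {N : ℕ} {A : Type*}

instance [Ring A] : AddCommGroup (AuxMat p N A) :=
  inferInstanceAs (AddCommGroup ((Fin N → Fin d) → (Fin N → Fin d) → A))

instance {K : Type*} [Semiring K] [Ring A] [Module K A] : Module K (AuxMat p N A) :=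
  inferInstanceAs (Module K ((Fin N → Fin d) → (Fin N → Fin d) → A))

@[ext] theorem ext {M M' : AuxMat p N A} (h : ∀ I J, M I J = M' I J) : M = M' :=
  funext fun I => funext fun J => h I J

@[simp] theorem add_apply [Ring A] (M M' : AuxMat p N A) (I J : Fin N → Fin d) :
    (M + M') I J = M I J + M' I J := rfl

@[simp] theorem zero_apply [Ring A] (I J : Fin N → Fin d) : (0 : AuxMat p N A) I J = 0 := rfl

@[simp] theorem smul_apply {K : Type*} [Semiring K] [Ring A] [Module K A] (k : K)
    (M : AuxMat p N A) (I J : Fin N → Fin d) : (k • M) I J = k • M I J := rfl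

/-- The parity of `E_{i_1 j_1} ⊗ ⋯ ⊗ E_{i_N j_N}`. -/
def deg (p : Fin d → ZMod 2) (I J : Fin N → Fin d) : ZMod 2 := ∑ q, (p (I q) + p (J q))

/-- The exponent of the sign in
`(E_{i_1 j_1} ⊗ ⋯ ⊗ E_{i_N j_N}) (E_{j_1 l_1} ⊗ ⋯ ⊗ E_{j_N l_N})
  = (-1)^{cross} E_{i_1 l_1} ⊗ ⋯ ⊗ E_{i_N l_N}`: the factor `E_{i_r j_r}` is moved through
`E_{j_q l_q}` for all `q < r`. -/
def cross (p : Fin d → ZMod 2) (I J L : Fin N → Fin d) : ZMod 2 :=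
  ∑ r, ∑ q, if q < r then (p (I r) + p (J r)) * (p (J q) + p (L q)) else 0

theorem deg_self (I : Fin N → Fin d) : deg p I I = 0 := by
  simp [deg, CharTwo.add_self_eq_zero]

theorem deg_add (I J L : Fin N → Fin d) : deg p I J + deg p J L = deg p I L := by
  simp only [deg, ← Finset.sum_add_distrib]
  refine Finset.sum_congr rfl fun q _ => ?_
  generalize p (I q) = x, p (J q) = y, p (L q) = z
  revert x y z; decide

theorem cross_self_left (I J : Fin N → Fin d) : cross p I I J = 0 := by
  simp [cross, CharTwo.add_self_eq_zero]

theorem cross_self_right (I J : Fin N → Fin d) : cross p I J J = 0 := by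
  simp [cross, CharTwo.add_self_eq_zero]

theorem cross_cocycle (I J L M : Fin N → Fin d) :
    cross p I L M + cross p I J L = cross p I J M + cross p J L M := by
  simp only [cross, ← Finset.sum_add_distrib]
  refine Finset.sum_congr rfl fun r _ => Finset.sum_congr rfl fun q _ => ?_
  split_ifs
  · generalize p (I r) = x, p (J r) = y, p (L r) = z, p (J q) = x', p (L q) = y', p (M q) = z'
    revert x y z x' y' z'; decide
  · simp

/-- Multiplication in the graded tensor product: besides the sign coming from the matrix factors,
the factor `M_{IJ}` of `A` is moved through `E_{j_1 l_1} ⊗ ⋯ ⊗ E_{j_N l_N}`. -/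
instance [Ring A] [ParityRing A] : Mul (AuxMat p N A) :=
  ⟨fun M M' I L => ∑ J, sgn (cross p I J L) • (grPow (deg p J L) (M I J) * M' J L)⟩

instance [Ring A] : One (AuxMat p N A) := ⟨fun I J => if I = J then 1 else 0⟩

theorem mul_apply [Ring A] [ParityRing A] (M M' : AuxMat p N A) (I L : Fin N → Fin d) :
    (M * M') I L = ∑ J, sgn (cross p I J L) • (grPow (deg p J L) (M I J) * M' J L) := rfl

theorem one_apply [Ring A] (I J : Fin N → Fin d) :
    (1 : AuxMat p N A) I J = if I = J then 1 else 0 := rfl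

instance [Ring A] [ParityRing A] : Ring (AuxMat p N A) where
  __ := (inferInstance : AddCommGroup (AuxMat p N A))
  left_distrib M M' M'' := by
    ext I L; simp [mul_apply, mul_add, Finset.sum_add_distrib]
  right_distrib M M' M'' := by
    ext I L; simp [mul_apply, add_mul, Finset.sum_add_distrib]
  zero_mul M := by ext I L; simp [mul_apply]
  mul_zero M := by ext I L; simp [mul_apply]
  one_mul M := by
    ext I L
    rw [mul_apply, Finset.sum_eq_single I]
    · simp [one_apply, cross_self_left, sgn]
    · intro J _ hJ
      simp [one_apply, hJ.symm]
    · simp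
  mul_one M := by
    ext I L
    rw [mul_apply, Finset.sum_eq_single L]
    · simp [one_apply, cross_self_right, deg_self, grPow_zero, sgn]
    · intro J _ hJ
      simp [one_apply, hJ]
    · simp
  mul_assoc M M' M'' := by
    ext I L
    simp only [mul_apply, map_sum, Finset.sum_mul, Finset.mul_sum, Finset.smul_sum]
    rw [Finset.sum_comm]
    refine Finset.sum_congr rfl fun J _ => Finset.sum_congr rfl fun J' _ => ?_
    rw [map_zsmul, map_mul, ← grPow_add, add_comm (deg p J' L), deg_add, smul_mul_assoc,
      mul_smul_comm, smul_smul, smul_smul, ← sgn_add, ← sgn_add, cross_cocycle, mul_assoc]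
  zsmul_zero' := (inferInstance : AddCommGroup (AuxMat p N A)).zsmul_zero'
  zsmul_succ' := (inferInstance : AddCommGroup (AuxMat p N A)).zsmul_succ'
  zsmul_neg' := (inferInstance : AddCommGroup (AuxMat p N A)).zsmul_neg'
  neg_add_cancel := (inferInstance : AddCommGroup (AuxMat p N A)).neg_add_cancel

/-- The elementary matrix `E_{ij}^{(r)}`, i.e. `E_{ij}` in the `r`-th copy of `End(ℂ^{m|n})` and
the unit matrix in the other copies. -/
def E [Ring A] (r : Fin N) (i j : Fin d) : AuxMat p N A :=
  fun I J => if I r = i ∧ J = Function.update I r j then 1 else 0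

/-- The element `T_r = ∑_{i,j} E_{ij}^{(r)} ⊗ t_{ij}`. -/
def ofEntries [Ring A] (r : Fin N) (t : Fin d → Fin d → A) : AuxMat p N A :=
  fun I J => ∑ i, ∑ j, (E r i j : AuxMat p N A) I J * t i j

/-- The super-trace over the `N` auxiliary spaces:
`E_{i_1 j_1} ⊗ ⋯ ⊗ E_{i_N j_N} ⊗ y ↦ str(E_{i_1 j_1}) ⋯ str(E_{i_N j_N}) y`, where
`str(E_{ij}) = (-1)^{[j]} δ_{ij}`. -/
def str [Ring A] (M : AuxMat p N A) : A := ∑ I, sgn (∑ r, p (I r)) • M I I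

/-- `R_{rs} = 1 + g P_{rs}`, where `P_{rs} = ∑_{i,j} (-1)^{[j]} E_{ij}^{(r)} E_{ji}^{(s)}` is the
graded permutation. -/
def Rmat {K : Type*} [CommRing K] [Ring A] [ParityRing A] [Algebra K A] (r s : Fin N) (g : K) :
    AuxMat p N A :=
  1 + g • ∑ i, ∑ j, sgn (p j) • ((E r i j : AuxMat p N A) * E s j i)

end AuxMat

/-! ### Formal Bethe parameters and series -/

section Series

variable (σ : Type)

/-- Rational functions in the Bethe parameters, written as rational functions in their inverses:
the variable `X s` stands for the inverse of the Bethe parameter with label `s`. -/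
abbrev RatFun : Type := FractionRing (MvPolynomial σ ℂ)

variable {σ}

/-- The Bethe parameter with label `s`. -/
def param (s : σ) : RatFun σ :=
  (algebraMap (MvPolynomial σ ℂ) (RatFun σ) (MvPolynomial.X s))⁻¹

/-- `g(u,v) = c/(u-v)`. -/
def gFun (c : ℂ) (s t : σ) : RatFun σ := algebraMap ℂ (RatFun σ) c / (param s - param t)

/-- `f(u,v) = 1 + g(u,v)`. -/
def fFun (c : ℂ) (s t : σ) : RatFun σ := 1 + gFun c s t

/-- `h(u,v) = f(u,v)/g(u,v)`. -/
def hFun (c : ℂ) (s t : σ) : RatFun σ := fFun c s t / gFun c s t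

/-- `H(w) = ∏_{k < j} h(w_j, w_k)`. -/
def HFun (c : ℂ) {b : ℕ} (w : Fin b → σ) : RatFun σ :=
  ∏ j, ∏ k, if k < j then hFun c (w j) (w k) else 1

/-- Polynomials in the inverse Bethe parameters, as central elements of the ring of formal power
series in the inverse Bethe parameters with coefficients in `Y(m|n)`. -/
def polyToSeries (m n : ℕ) (σ : Type) :
    MvPolynomial σ ℂ →+* MvPowerSeries σ (Yangian m n) :=
  (MvPowerSeries.map (algebraMap ℂ (Yangian m n))).comp MvPolynomial.coeToMvPowerSeries.ringHom

theorem coeff_polyToSeries (m n : ℕ) (q : MvPolynomial σ ℂ) (e : σ →₀ ℕ) :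
    MvPowerSeries.coeff e (polyToSeries m n σ q) = algebraMap ℂ (Yangian m n) (q.coeff e) := by
  simp [polyToSeries]

instance (m n : ℕ) : Algebra (MvPolynomial σ ℂ) (MvPowerSeries σ (Yangian m n)) :=
  RingHom.toAlgebra' (polyToSeries m n σ) (by
    intro q y
    classical
    ext e
    simp only [MvPowerSeries.coeff_mul, coeff_polyToSeries]
    refine (Finset.sum_congr rfl fun x _ => Algebra.commutes _ _).trans ?_
    exact Finsupp.sum_antidiagonal_swap e fun x x' => MvPowerSeries.coeff x' y *
      algebraMap ℂ (Yangian m n) (q.coeff x))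

theorem coeff_poly_smul [DecidableEq σ] (m n : ℕ) (q : MvPolynomial σ ℂ)
    (y : MvPowerSeries σ (Yangian m n)) (e : σ →₀ ℕ) :
    MvPowerSeries.coeff e (q • y)
      = ∑ x ∈ Finset.HasAntidiagonal.antidiagonal e, q.coeff x.1 • MvPowerSeries.coeff x.2 y := by
  rw [Algebra.smul_def, MvPowerSeries.coeff_mul]
  refine Finset.sum_congr rfl fun x _ => ?_
  rw [Algebra.smul_def]
  exact congrArg (· * _) <| coeff_polyToSeries m n q x.1

/-- The algebra `ℂ(u) ⊗ Y(m|n)[[u⁻¹]]` of formal power series in the inverse Bethe parameters with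
coefficients in `Y(m|n)`, with rational functions of the Bethe parameters as scalars. -/
abbrev YSeries (m n : ℕ) (σ : Type) : Type :=
  RatFun σ ⊗[MvPolynomial σ ℂ] MvPowerSeries σ (Yangian m n)

/-- The grading automorphism applied to the coefficients of a series. -/
def grPowerSeries (m n : ℕ) (σ : Type) :
    MvPowerSeries σ (Yangian m n) →ₐ[MvPolynomial σ ℂ] MvPowerSeries σ (Yangian m n) where
  __ := MvPowerSeries.map (gr m n).toRingHom
  commutes' q := by
    ext e
    change gr m n (MvPowerSeries.coeff e (polyToSeries m n σ q))
      = MvPowerSeries.coeff e (polyToSeries m n σ q)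
    rw [coeff_polyToSeries, AlgHom.commutes]

theorem grPowerSeries_grPowerSeries (m n : ℕ) (y : MvPowerSeries σ (Yangian m n)) :
    grPowerSeries m n σ (grPowerSeries m n σ y) = y := by
  ext e
  exact gr_gr m n (MvPowerSeries.coeff e y)

instance (m n : ℕ) : ParityRing (YSeries m n σ) where
  gr := (Algebra.TensorProduct.map (AlgHom.id (RatFun σ) (RatFun σ))
    (grPowerSeries m n σ)).toRingHom
  gr_gr y := by
    change Algebra.TensorProduct.map (AlgHom.id (RatFun σ) (RatFun σ)) (grPowerSeries m n σ)
      (Algebra.TensorProduct.map (AlgHom.id (RatFun σ) (RatFun σ)) (grPowerSeries m n σ) y) = y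
    induction y using TensorProduct.induction_on with
    | zero => simp
    | tmul k y => simp [grPowerSeries_grPowerSeries]
    | add y z hy hz => rw [map_add, map_add, hy, hz]

/-- The series `T_{ij}(u) = ∑_r mode_{ij,r} c^r u^{-r}`, where `u` is the Bethe parameter with
label `s`. -/
def tSeries (m n : ℕ) (c : ℂ) (s : σ) (i j : Fin (m + n)) : MvPowerSeries σ (Yangian m n) :=
  open Classical in
  fun e => if e = Finsupp.single s (e s) then c ^ (e s) • mode m n i j (e s) else 0

/-- `T_r(u) = ∑_{i,j} E_{ij}^{(r)} ⊗ T_{ij}(u)`, where `u` is the Bethe parameter with label `s`. -/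
def Tmat (m n : ℕ) (c : ℂ) {N : ℕ} (r : Fin N) (s : σ) :
    AuxMat (par m n) N (YSeries m n σ) :=
  AuxMat.ofEntries r fun i j => 1 ⊗ₜ tSeries m n c s i j

/-- The product
`(R_{a+1,a} ⋯ R_{a+1,1}) (R_{a+2,a} ⋯ R_{a+2,1}) ⋯ (R_{a+b,a} ⋯ R_{a+b,1})`, where
`R_{a+j,k} = R_{a+j,k}(v_j, u_k)`. -/
def RR (m n : ℕ) (c : ℂ) {a b : ℕ} (u : Fin a → σ) (v : Fin b → σ) :
    AuxMat (par m n) (a + b) (YSeries m n σ) :=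
  ((List.finRange b).map fun j =>
    ((List.finRange a).reverse.map fun k =>
      AuxMat.Rmat (Fin.natAdd a j) (Fin.castAdd b k) (gFun c (v j) (u k))).prod).prod

/-- `T_1(u_1) ⋯ T_a(u_a) T_{a+1}(v_1) ⋯ T_{a+b}(v_b)`. -/
def TT (m n : ℕ) (c : ℂ) {a b : ℕ} (u : Fin a → σ) (v : Fin b → σ) :
    AuxMat (par m n) (a + b) (YSeries m n σ) :=
  ((List.finRange a).map fun k => Tmat m n c (Fin.castAdd b k) (u k)).prod *
    ((List.finRange b).map fun j => Tmat m n c (Fin.natAdd a j) (v j)).prod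

/-- `E_{ij}^{(1)} ⋯ E_{ij}^{(a)} E_{kl}^{(a+1)} ⋯ E_{kl}^{(a+b)}`. -/
def EE (m n : ℕ) (σ : Type) (a b : ℕ) (i j k l : Fin (m + n)) :
    AuxMat (par m n) (a + b) (YSeries m n σ) :=
  ((List.finRange a).map fun r => AuxMat.E (Fin.castAdd b r) i j).prod *
    ((List.finRange b).map fun r => AuxMat.E (Fin.natAdd a r) k l).prod

/-- `str_{1…a+b} [T_1(u_1) ⋯ T_a(u_a) T_{a+1}(v_1) ⋯ T_{a+b}(v_b) 𝐑_{1…a+b}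
  E_{ij}^{(1)} ⋯ E_{ij}^{(a)} E_{kl}^{(a+1)} ⋯ E_{kl}^{(a+b)}]`. -/
def superTrace (m n : ℕ) (c : ℂ) {a b : ℕ} (u : Fin a → σ) (v : Fin b → σ)
    (i j k l : Fin (m + n)) : YSeries m n σ :=
  (TT m n c u v * RR m n c u v * EE m n σ a b i j k l).str

/-! ### Series with coefficients in a vector space -/

/-- Formal power series in the inverse Bethe parameters with coefficients in a vector space `V`. -/
def VecSeries (σ : Type) (V : Type*) : Type _ := (σ →₀ ℕ) → V

variable {V W : Type*} [AddCommGroup V] [Module ℂ V] [AddCommGroup W] [Module ℂ W]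

instance : AddCommGroup (VecSeries σ V) := inferInstanceAs (AddCommGroup ((σ →₀ ℕ) → V))

/-- Polynomials in the inverse Bethe parameters act on series by the Cauchy product. -/
instance : SMul (MvPolynomial σ ℂ) (VecSeries σ V) :=
  letI := Classical.decEq σ
  ⟨fun q F e => ∑ x ∈ Finset.HasAntidiagonal.antidiagonal e, q.coeff x.1 • F x.2⟩

theorem vecSeries_smul_apply [DecidableEq σ] (q : MvPolynomial σ ℂ) (F : VecSeries σ V)
    (e : σ →₀ ℕ) : (q • F) e = ∑ x ∈ Finset.HasAntidiagonal.antidiagonal e, q.coeff x.1 • F x.2 := by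
  refine Finset.sum_congr ?_ fun _ _ => rfl
  rw [Subsingleton.elim (Classical.decEq σ) ‹DecidableEq σ›]

instance : Module (MvPolynomial σ ℂ) (VecSeries σ V) where
  one_smul F := by
    classical
    funext e
    rw [vecSeries_smul_apply, Finset.sum_eq_single (0, e)]
    · simp
    · rintro ⟨x, y⟩ hx hne
      have : x ≠ 0 := by
        rintro rfl
        simp at hx
        exact hne (by simp [hx])
      simp [MvPolynomial.coeff_one, this.symm]
    · simp
  mul_smul q q' F := by
    classical
    funext e
    simp only [vecSeries_smul_apply, MvPolynomial.coeff_mul, Finset.sum_smul, Finset.smul_sum,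
      Finset.sum_sigma']
    apply Finset.sum_nbij' (fun ⟨⟨_i, j⟩, ⟨k, l⟩⟩ ↦ ⟨(k, l + j), (l, j)⟩)
      (fun ⟨⟨i, _j⟩, ⟨k, l⟩⟩ ↦ ⟨(i + k, l), (i, k)⟩) <;> simp <;> grind [mul_smul]
  smul_zero q := by
    classical
    funext e
    rw [vecSeries_smul_apply]
    exact Finset.sum_eq_zero fun x _ => smul_zero _
  smul_add q F G := by
    classical
    funext e
    change (q • (F + G)) e = (q • F) e + (q • G) e
    simp only [vecSeries_smul_apply, ← Finset.sum_add_distrib]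
    exact Finset.sum_congr rfl fun x _ => smul_add _ _ _
  add_smul q q' F := by
    classical
    funext e
    change ((q + q') • F) e = (q • F) e + (q' • F) e
    simp only [vecSeries_smul_apply, ← Finset.sum_add_distrib, MvPolynomial.coeff_add, add_smul]
  zero_smul F := by
    classical
    funext e
    rw [vecSeries_smul_apply]
    exact Finset.sum_eq_zero fun x _ => by simp

/-- Formal series with coefficients in `V`, with rational functions of the Bethe parameters as
scalars. -/
abbrev VSeries (σ : Type) (V : Type*) [AddCommGroup V] [Module ℂ V] : Type _ :=
  RatFun σ ⊗[MvPolynomial σ ℂ] VecSeries σ V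

/-- A linear map `Y(m|n) → V`, applied to the coefficients of series. -/
def applyY {m n : ℕ} (σ : Type) (L : Yangian m n →ₗ[ℂ] V) :
    YSeries m n σ →ₗ[RatFun σ] VSeries σ V :=
  LinearMap.baseChange (RatFun σ)
    ({ toFun := fun y e => L (MvPowerSeries.coeff e y)
       map_add' := fun y z => by
        funext e
        change L _ = L _ + L _
        rw [← map_add, ← map_add]
       map_smul' := fun q y => by
        classical
        funext e
        refine Eq.trans ?_ (vecSeries_smul_apply q _ e).symm
        rw [coeff_poly_smul, map_sum]
        exact Finset.sum_congr rfl fun x _ => map_smul L _ _ } :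
      MvPowerSeries σ (Yangian m n) →ₗ[MvPolynomial σ ℂ] VecSeries σ V)

/-- A linear map `V → W`, applied to the coefficients of series. -/
def applyV (σ : Type) (L : V →ₗ[ℂ] W) : VSeries σ V →ₗ[RatFun σ] VSeries σ W :=
  LinearMap.baseChange (RatFun σ)
    ({ toFun := fun F e => L (F e)
       map_add' := fun F G => by
        funext e
        exact map_add L _ _
       map_smul' := fun q F => by
        classical
        funext e
        refine Eq.trans ?_ (vecSeries_smul_apply q _ e).symm
        rw [vecSeries_smul_apply, map_sum]
        exact Finset.sum_congr rfl fun x _ => map_smul L _ _ } :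
      VecSeries σ V →ₗ[MvPolynomial σ ℂ] VecSeries σ W)

end Series

/-! ### Highest weight representations and their duals -/

section Reps

variable {m n : ℕ} {V : Type*} [AddCommGroup V] [Module ℂ V] [Module (Yangian m n) V]
  [IsScalarTower ℂ (Yangian m n) V]

variable (m n) in
/-- `V` is a `ℤ/2ℤ`-graded representation of `Y(m|n)` generated by the even singular vector `Ω`:
`T_{ii}(u) Ω = λ_i(u) Ω` and `T_{ij}(u) Ω = 0` for `i > j`, where
`λ_i(u) = 1 + ∑_{p ≥ 0} λ_i^{(p)} (c/u)^{p+1}`. The grading is given by its involution `P`, equal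
to `±1` on even, respectively odd, vectors. -/
structure IsHighestWeight (Ω : V) : Prop where
  generates : ∀ w : V, ∃ y : Yangian m n, y • Ω = w
  weight : ∃ lam : Fin (m + n) → ℕ → ℂ, ∀ i r, mode m n i i (r + 1) • Ω = lam i r • Ω
  annihilate : ∀ i j, j < i → ∀ r, mode m n i j r • Ω = 0
  graded : ∃ P : V →ₗ[ℂ] V, P ∘ₗ P = LinearMap.id ∧ P Ω = Ω ∧
    ∀ (y : Yangian m n) (w : V), P (y • w) = gr m n y • P w

variable (m n) in
/-- `y ↦ y Ω`. -/
def act (Ω : V) : Yangian m n →ₗ[ℂ] V :=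
  (LinearMap.toSpanSingleton (Yangian m n) V Ω).restrictScalars ℂ

variable (m n) in
/-- The right ideal of `Y(m|n)` generated by the elements `ψ(y)` with `y Ω = 0`. -/
def dualIdeal (Ω : V) : Submodule (Yangian m n)ᵐᵒᵖ (Yangian m n) :=
  Submodule.span _ (transpose m n '' {y | y • Ω = 0})

variable (m n) in
/-- The left representation (right module) of `Y(m|n)` dual to `V`: it is the image of
`V ≅ Y(m|n) / Ann(Ω)` under `ψ`, namely `Y(m|n) / ψ(Ann(Ω))`. -/
abbrev Dual (Ω : V) : Type := Yangian m n ⧸ dualIdeal m n Ω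

theorem ker_act_le (Ω : V) : LinearMap.ker (act m n Ω) ≤
    LinearMap.ker (((dualIdeal m n Ω).mkQ.restrictScalars ℂ) ∘ₗ transpose m n) := by
  intro y hy
  have hy' : y • Ω = 0 := hy
  exact (Submodule.Quotient.mk_eq_zero _).2 (Submodule.subset_span ⟨y, hy', rfl⟩)

/-- The transposition map `ψ` from a highest weight representation to its dual, `y Ω ↦ [ψ(y)]`. -/
def transposeVec {Ω : V} (h : IsHighestWeight m n Ω) : V →ₗ[ℂ] Dual m n Ω :=
  ((LinearMap.ker (act m n Ω)).liftQ _ (ker_act_le Ω)) ∘ₗ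
    ((act m n Ω).quotKerEquivOfSurjective h.generates).symm.toLinearMap

theorem transposeVec_smul {Ω : V} (h : IsHighestWeight m n Ω) (y : Yangian m n) :
    transposeVec h (y • Ω) = Submodule.Quotient.mk (transpose m n y) := by
  have : ((act m n Ω).quotKerEquivOfSurjective h.generates).symm (y • Ω)
      = Submodule.Quotient.mk y := by
    rw [LinearEquiv.symm_apply_eq]; rfl
  simp only [transposeVec, LinearMap.comp_apply, LinearEquiv.coe_coe, this]
  rfl

/-- The dual singular vector `Ω† = ψ(Ω)`. -/
def OmegaDag {Ω : V} (h : IsHighestWeight m n Ω) : Dual m n Ω := transposeVec h Ω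

/-- `y ↦ Ω† y`. -/
def dualAct {Ω : V} (h : IsHighestWeight m n Ω) : Yangian m n →ₗ[ℂ] Dual m n Ω where
  toFun y := MulOpposite.op y • OmegaDag h
  map_add' y z := by rw [MulOpposite.op_add, add_smul]
  map_smul' k y := by rw [MulOpposite.op_smul, smul_assoc, RingHom.id_apply]

/-- The defining property of `ψ` on vectors, `ψ(y Ω) = Ω† ψ(y)`. -/
theorem transposeVec_smul_eq {Ω : V} (h : IsHighestWeight m n Ω) (y : Yangian m n) :
    transposeVec h (y • Ω) = MulOpposite.op (transpose m n y) • OmegaDag h := by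
  have : OmegaDag h = Submodule.Quotient.mk 1 := by
    have h1 := transposeVec_smul h 1
    rw [transpose_one, one_smul] at h1
    exact h1
  rw [this, transposeVec_smul, ← Submodule.Quotient.mk_smul]
  simp

theorem chi_chi (y : Yangian m n) : (chi m n (chi m n y).unop).unop = y := by
  let θ : Yangian m n →ₐ[ℂ] Yangian m n :=
    { toFun := fun y => (chi m n (chi m n y).unop).unop
      map_one' := by simp
      map_mul' := fun y z => by simp
      map_zero' := by simp
      map_add' := fun y z => by simp
      commutes' := fun k => by simp [Algebra.algebraMap_eq_smul_one] }
  have : θ = AlgHom.id ℂ _ := by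
    apply algHom_ext
    intro i j r
    change (chi m n (chi m n (mode m n i j r)).unop).unop = mode m n i j r
    rw [chi_mode, MulOpposite.unop_op, map_smul, chi_mode, MulOpposite.unop_smul,
      MulOpposite.unop_op, smul_smul]
    have : chiCoef m n i j * chiCoef m n j i = 1 := by
      have h2 : (1 + 1 : ZMod 2) = 0 := by decide
      unfold chiCoef
      generalize par m n i = x, par m n j = y
      rcases parity_cases x with rfl | rfl <;> rcases parity_cases y with rfl | rfl <;>
        simp [sgn, quarter, h2]
    rw [this, one_smul]
  exact DFunLike.congr_fun this y

theorem transpose_eq (y : Yangian m n) : transpose m n y =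
    (chi m n (((1 - Complex.I) / 2) • y + ((1 + Complex.I) / 2) • gr m n y)).unop := by
  have e : ∀ z, chiLin m n z = (chi m n z).unop := fun _ => rfl
  simp only [transpose, LinearMap.sub_apply, LinearMap.comp_apply, LinearMap.smul_apply,
    LinearMap.add_apply, LinearMap.id_apply, AlgHom.toLinearMap_apply, e, map_add, map_sub,
    map_smul, MulOpposite.unop_add, MulOpposite.unop_sub, MulOpposite.unop_smul]
  module

theorem gr_smul_eq_zero {m n : ℕ} {V : Type*} [AddCommGroup V] [Module ℂ V]
    [Module (Yangian m n) V] {Ω : V} (h : IsHighestWeight m n Ω) {y : Yangian m n}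
    (hy : y • Ω = 0) :
    gr m n y • Ω = 0 := by
  obtain ⟨P, -, hP, hP'⟩ := h.graded
  have := hP' y Ω
  rwa [hy, map_zero, hP, eq_comm] at this

/-- The image of `Ann(Ω)` under `ψ` is itself the right ideal `dualIdeal`. -/
theorem transpose_mem_dualIdeal_iff {Ω : V} (h : IsHighestWeight m n Ω) (y : Yangian m n) :
    transpose m n y ∈ dualIdeal m n Ω ↔ y • Ω = 0 := by
  have key : ∀ z ∈ dualIdeal m n Ω, (chi m n z).unop • Ω = 0 := by
    intro z hz
    induction hz using Submodule.span_induction with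
    | mem z hz =>
      obtain ⟨y, hy, rfl⟩ := hz
      have hy' : y • Ω = 0 := hy
      rw [transpose_eq, chi_chi, add_smul, smul_assoc, smul_assoc, hy', gr_smul_eq_zero h hy']
      simp
    | zero => simp
    | add z w _ _ hz hw => rw [map_add, MulOpposite.unop_add, add_smul, hz, hw, add_zero]
    | smul a z _ hz =>
      rw [← MulOpposite.op_unop a, op_smul_eq_mul, map_mul, MulOpposite.unop_mul, mul_smul, hz,
        smul_zero]
  refine ⟨fun hy => ?_, fun hy => Submodule.subset_span ⟨y, hy, rfl⟩⟩
  have h1 := key _ hy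
  rw [transpose_eq, chi_chi] at h1
  have h2 := gr_smul_eq_zero h h1
  rw [map_add, map_smul, map_smul, gr_gr] at h2
  have h3 : y = ((1 + Complex.I) / 2) •
      (((1 - Complex.I) / 2) • y + ((1 + Complex.I) / 2) • gr m n y)
      + ((1 - Complex.I) / 2) •
      (((1 - Complex.I) / 2) • gr m n y + ((1 + Complex.I) / 2) • y) := by
    match_scalars
    · linear_combination (1 / 2) * Complex.I_sq
    · linear_combination (-1 / 2) * Complex.I_sq
  rw [h3, add_smul, smul_assoc, smul_assoc, h1, h2, smul_zero, smul_zero, add_zero]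

/-- `ψ` is injective on vectors; in particular `Ω† ≠ 0` if `Ω ≠ 0`. -/
theorem transposeVec_injective {Ω : V} (h : IsHighestWeight m n Ω) :
    Function.Injective (transposeVec h) := by
  rw [injective_iff_map_eq_zero]
  intro w hw
  obtain ⟨y, rfl⟩ := h.generates w
  rw [transposeVec_smul, Submodule.Quotient.mk_eq_zero] at hw
  exact (transpose_mem_dualIdeal_iff h y).1 hw

end Reps

/-! ### Bethe vectors and dual Bethe vectors

In the code the indices `1, 2, 3` are `0, 1, 2`. -/

section Bethe

variable {σ : Type}

/-- The conjugate `w* = {w_b, …, w_1}` of the ordered set `w = {w_1, …, w_b}`. -/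
def conj {b : ℕ} (w : Fin b → σ) : Fin b → σ := fun j => w j.rev

/-- The Bethe vector `Φ_{ab}(u,v)` of `Y(2|1)`:
`(-1)^b / H(v) · str[T ⋯ T 𝐑 E_{21}^{(1)} ⋯ E_{21}^{(a)} E_{32}^{(a+1)} ⋯ E_{32}^{(a+b)}] Ω`. -/
def bethe21 {V : Type*} [AddCommGroup V] [Module ℂ V] [Module (Yangian 2 1) V]
    [IsScalarTower ℂ (Yangian 2 1) V] (c : ℂ) (Ω : V) {a b : ℕ} (u : Fin a → σ) (v : Fin b → σ) :
    VSeries σ V :=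
  ((-1) ^ b / HFun c v) • applyY σ (act 2 1 Ω) (superTrace 2 1 c u v 1 0 2 1)

/-- The Bethe vector `Φ_{ab}(u,v)` of `Y(1|2)`:
`(-1)^a / H(u) · str[T ⋯ T 𝐑 E_{21}^{(1)} ⋯ E_{21}^{(a)} E_{32}^{(a+1)} ⋯ E_{32}^{(a+b)}] Ω`. -/
def bethe12 {V : Type*} [AddCommGroup V] [Module ℂ V] [Module (Yangian 1 2) V]
    [IsScalarTower ℂ (Yangian 1 2) V] (c : ℂ) (Ω : V) {a b : ℕ} (u : Fin a → σ) (v : Fin b → σ) :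
    VSeries σ V :=
  ((-1) ^ a / HFun c u) • applyY σ (act 1 2 Ω) (superTrace 1 2 c u v 1 0 2 1)

/-- The dual Bethe vector `Ψ_{ab}(u,v) = ψ(Φ_{ab}(u*,v*))` of `Y(2|1)`. -/
def dualBethe21 {V : Type*} [AddCommGroup V] [Module ℂ V] [Module (Yangian 2 1) V]
    [IsScalarTower ℂ (Yangian 2 1) V] (c : ℂ) {Ω : V} (h : IsHighestWeight 2 1 Ω) {a b : ℕ}
    (u : Fin a → σ) (v : Fin b → σ) : VSeries σ (Dual 2 1 Ω) :=
  applyV σ (transposeVec h) (bethe21 c Ω (conj u) (conj v))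

/-- The dual Bethe vector `Ψ_{ab}(u,v) = ψ(Φ_{ab}(u*,v*))` of `Y(1|2)`. -/
def dualBethe12 {V : Type*} [AddCommGroup V] [Module ℂ V] [Module (Yangian 1 2) V]
    [IsScalarTower ℂ (Yangian 1 2) V] (c : ℂ) {Ω : V} (h : IsHighestWeight 1 2 Ω) {a b : ℕ}
    (u : Fin a → σ) (v : Fin b → σ) : VSeries σ (Dual 1 2 Ω) :=
  applyV σ (transposeVec h) (bethe12 c Ω (conj u) (conj v))

/-- `Ω† · y` for a series `y` with coefficients in `Y(m|n)`. -/
def applyOmegaDag {m n : ℕ} {V : Type*} [AddCommGroup V] [Module ℂ V] [Module (Yangian m n) V]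
    [IsScalarTower ℂ (Yangian m n) V] {Ω : V} (h : IsHighestWeight m n Ω) :
    YSeries m n σ →ₗ[RatFun σ] VSeries σ (Dual m n Ω) :=
  applyY σ (dualAct h)

end Bethe

end SuperYangian

end

namespace SuperYangian

/-! On `End(ℂ^{m|n})^{⊗N} ⊗ A`, let τ be the tensor product of the graded matrix transpositions
`E_{ij} ↦ (-1)^{[i][j]+[i]} E_{ji}` with ψ on the coefficients. The diagonal matrix units are fixed
and the super-trace sees only the diagonal, so `ψ(str X) = str(τ X)` (`str_gradedTranspose`).
Moreover τ is a graded antimorphism (`gradedTranspose_mul`). It fixes every `T_r(u)`, because the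
sign of the matrix transposition cancels the one in `ψ(T_{ij}(u))`, and it fixes every `R_{rs}`,
because the graded permutation is symmetric.

Hence ψ turns `str[𝕋 ℝ E]`, taken at the reversed tuples `u*`, `v*`, into `± str[E' ℝ' 𝕋']`, where
every product is written backwards and each `E_{ij}` has become `E_{ji}`. Relabelling the auxiliary
spaces by the permutation that reverses each of the two blocks is a ring homomorphism preserving the
super-trace (`permHom`, `str_permHom`). It undoes the reversal of the parameters and restores the
order inside each block: ℝ' becomes ℝ, E' becomes the product of the `E_{ji}` in increasing order,
and 𝕋' becomes the v-block of T's followed by the u-block.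

The two blocks of T's are still in the wrong order. The RTT relation
(`Rmat_mul_ofEntries_mul_ofEntries`), used once for each pair of a u and a v, gives `ℝ · T(v)⋯T(v)
T(u)⋯T(u) = 𝕋 ℝ` (`RR_mul_TT`). What remains is `± str[E' 𝕋 ℝ]`; since 𝕋ℝ is even and E' has integer
entries, cyclicity (`str_mul_comm`) moves E' to the right without a sign. This is
`transposeSeries_superTrace`.

The sign comes only from the E's. Each odd factor `E_{32}` (for `Y(2|1)`) or `E_{21}` (for `Y(1|2)`)
contributes `-1`, and reversing N odd factors contributes `(-1)^{N(N-1)/2}`; the other block is even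
and contributes nothing. The part `(-1)^N` cancels the same factor in the normalization
(`dual_eq_of_sign`). -/

theorem sgn_mul_self (x : ZMod 2) : sgn x * sgn x = 1 := by
  revert x; decide

theorem sgn_zero : sgn 0 = 1 := rfl

namespace AuxMat

variable {d : ℕ} {p : Fin d → ZMod 2} {N : ℕ} {A : Type*}

/-! ### Elementary matrices, constants and their products -/

theorem E_apply [Ring A] (r : Fin N) (i j : Fin d) (I J : Fin N → Fin d) :
    (E r i j : AuxMat p N A) I J = if I r = i ∧ J = Function.update I r j then 1 else 0 := rfl

theorem ofEntries_apply [Ring A] (r : Fin N) (t : Fin d → Fin d → A) (I J : Fin N → Fin d) :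
    (ofEntries r t : AuxMat p N A) I J
      = if J = Function.update I r (J r) then t (I r) (J r) else 0 := by
  simp only [ofEntries, E_apply]
  rw [Finset.sum_eq_single (I r), Finset.sum_eq_single (J r)]
  · simp
  · intro j _ hj
    rw [if_neg, zero_mul]
    rintro ⟨-, h⟩
    exact hj (by rw [h]; simp)
  · simp
  · intro i _ hi
    exact Finset.sum_eq_zero fun j _ => by rw [if_neg (fun h => hi h.1.symm), zero_mul]
  · simp

theorem E_eq_ofEntries [Ring A] (r : Fin N) (i j : Fin d) :
    (E r i j : AuxMat p N A) = ofEntries r fun k l => if k = i ∧ l = j then 1 else 0 := by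
  ext I J
  rw [ofEntries_apply, E_apply, ← ite_and]
  refine if_congr ⟨?_, ?_⟩ rfl rfl
  · rintro ⟨h, rfl⟩
    simp [h]
  · rintro ⟨h, h1, h2⟩
    rw [h2] at h
    exact ⟨h1, h⟩

theorem zsmul_apply [Ring A] (k : ℤ) (M : AuxMat p N A) (I J : Fin N → Fin d) :
    (k • M) I J = k • M I J := rfl

theorem zsmul_apply' [Ring A] [ParityRing A] (k : ℤ) (M : AuxMat p N A) (I J : Fin N → Fin d) :
    (k • M) I J = k • M I J := rfl

/-- The element `1 ⊗ ⋯ ⊗ 1 ⊗ y`. -/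
def const [Ring A] (y : A) : AuxMat p N A := fun I J => if I = J then y else 0

theorem const_apply [Ring A] (y : A) (I J : Fin N → Fin d) :
    (const y : AuxMat p N A) I J = if I = J then y else 0 := rfl

theorem mul_const_apply [Ring A] [ParityRing A] (M : AuxMat p N A) (y : A)
    (I J : Fin N → Fin d) : (M * const y : AuxMat p N A) I J = M I J * y := by
  rw [mul_apply, Finset.sum_eq_single J]
  · simp [const_apply, cross_self_right, deg_self, grPow_zero, sgn]
  · intro K _ hK
    simp [const_apply, hK]
  · simp

theorem const_mul_apply [Ring A] [ParityRing A] (M : AuxMat p N A) (y : A)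
    (I J : Fin N → Fin d) : (const y * M : AuxMat p N A) I J = grPow (deg p I J) y * M I J := by
  rw [mul_apply, Finset.sum_eq_single I]
  · simp [const_apply, cross_self_left, sgn]
  · intro K _ hK
    simp [const_apply, hK.symm]
  · simp

theorem const_mul_const [Ring A] [ParityRing A] (y z : A) :
    (const y * const z : AuxMat p N A) = const (y * z) := by
  ext I J
  rw [mul_const_apply, const_apply, const_apply, ite_mul, zero_mul]

theorem const_add [Ring A] (y z : A) :
    (const (y + z) : AuxMat p N A) = const y + const z := by
  ext I J; simp only [const_apply, add_apply]; split_ifs <;> simp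

theorem const_zsmul [Ring A] (k : ℤ) (y : A) :
    (const (k • y) : AuxMat p N A) = k • const y := by
  ext I J
  rw [zsmul_apply, const_apply, const_apply]; split_ifs <;> simp

theorem sum_apply [Ring A] {ι : Type*} (s : Finset ι) (F : ι → AuxMat p N A)
    (I J : Fin N → Fin d) : (∑ x ∈ s, F x) I J = ∑ x ∈ s, F x I J := by
  classical
  induction s using Finset.induction_on with
  | empty => rfl
  | insert a s ha ih => rw [Finset.sum_insert ha, Finset.sum_insert ha, add_apply, ih]

theorem ofEntries_eq_sum [Ring A] [ParityRing A] (r : Fin N) (t : Fin d → Fin d → A) :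
    (ofEntries r t : AuxMat p N A) = ∑ i, ∑ j, E r i j * const (t i j) := by
  ext I J
  simp only [sum_apply, mul_const_apply]
  rfl

theorem deg_update (I : Fin N → Fin d) (r : Fin N) (j : Fin d) :
    deg p I (Function.update I r j) = p (I r) + p j := by
  rw [deg, Finset.sum_eq_single r]
  · simp
  · intro q _ hq
    simp [hq, CharTwo.add_self_eq_zero]
  · simp

theorem grPow_of_homogeneous [Ring A] [ParityRing A] {x : ZMod 2} {y : A}
    (hy : ParityRing.gr y = sgn x • y) (z : ZMod 2) : grPow z y = sgn (z * x) • y := by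
  rcases parity_cases z with rfl | rfl
  · simp [grPow, sgn]
  · simp [grPow, hy]

theorem const_mul_E [Ring A] [ParityRing A] {x : ZMod 2} {y : A}
    (hy : ParityRing.gr y = sgn x • y) (r : Fin N) (i j : Fin d) :
    (const y * E r i j : AuxMat p N A) = sgn (x * (p i + p j)) • (E r i j * const y) := by
  ext I J
  rw [const_mul_apply, zsmul_apply', mul_const_apply, E_apply, grPow_of_homogeneous hy]
  split_ifs with h
  · rw [h.2, deg_update, h.1, mul_one, one_mul, mul_comm]
  · simp

theorem E_mul_apply [Ring A] [ParityRing A] (r : Fin N) (i j : Fin d) (M : AuxMat p N A)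
    (I L : Fin N → Fin d) : (E r i j * M : AuxMat p N A) I L = if I r = i then
      sgn (cross p I (Function.update I r j) L) • M (Function.update I r j) L else 0 := by
  rw [mul_apply, Finset.sum_eq_single (Function.update I r j)]
  · simp only [E_apply, and_true]
    split_ifs <;> simp
  · intro K _ hK
    simp [E_apply, hK]
  · simp

/-- All three multi-indices agree away from the slot r, while each term of `cross` involves two
different slots, so one of its factors is a doubled parity and vanishes. -/
theorem cross_update_self (I L : Fin N → Fin d) (r : Fin N) (j : Fin d)
    (h : L = Function.update I r (L r)) : cross p I (Function.update I r j) L = 0 := by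
  refine Finset.sum_eq_zero fun s _ => Finset.sum_eq_zero fun q _ => ?_
  split_ifs with hq
  · by_cases hs : s = r
    · subst hs
      rw [h]
      simp [hq.ne, CharTwo.add_self_eq_zero]
    · simp [hs, CharTwo.add_self_eq_zero]
  · rfl

/-- The first step changes only the slot r and the second only the slot s, so the pair (r, s) alone
can contribute, and it does so only if the first factor has to pass over the second. -/
theorem cross_update_update (I : Fin N → Fin d) {r s : Fin N} (hrs : r ≠ s) (j l : Fin d) :
    cross p I (Function.update I r j) (Function.update (Function.update I r j) s l)
      = if s < r then (p (I r) + p j) * (p (I s) + p l) else 0 := by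
  rw [cross, Finset.sum_eq_single r, Finset.sum_eq_single s]
  · simp [hrs.symm]
  · intro q _ hq
    simp [hq, CharTwo.add_self_eq_zero]
  · simp
  · intro q _ hq
    simp [hq, CharTwo.add_self_eq_zero]
  · simp

theorem E_mul_E_same [Ring A] [ParityRing A] (r : Fin N) (i j k l : Fin d) :
    (E r i j * E r k l : AuxMat p N A) = if j = k then E r i l else 0 := by
  ext I L
  rw [E_mul_apply, E_apply]
  by_cases hjk : j = k
  · subst hjk
    rw [if_pos rfl, E_apply]
    by_cases hI : I r = i
    · by_cases hL : L = Function.update I r l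
      · rw [cross_update_self]
        · simp [hI, hL, sgn]
        · rw [hL]; simp
      · simp [hI, hL]
    · simp [hI]
  · simp [hjk]

/-- Of the two orders of multiplication, exactly one produces the Koszul sign through `cross`: the
one in which the later slot comes first. -/
theorem E_mul_E_comm [Ring A] [ParityRing A] {r s : Fin N} (hrs : r ≠ s) (i j k l : Fin d) :
    (E r i j * E s k l : AuxMat p N A)
      = sgn ((p i + p j) * (p k + p l)) • (E s k l * E r i j) := by
  ext I L
  rw [zsmul_apply', E_mul_apply, E_mul_apply, E_apply, E_apply]
  by_cases hr : I r = i
  · by_cases hs : I s = k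
    · rw [Function.update_comm hrs.symm]
      by_cases hL : L = Function.update (Function.update I r j) s l
      · have e1 := cross_update_update (p := p) I hrs j l
        have e2 := cross_update_update (p := p) I hrs.symm l j
        rw [Function.update_comm hrs.symm] at e2
        rw [hL, e1, e2]
        rcases lt_or_gt_of_ne hrs with h | h
        · simp [hr, hs, hrs, hrs.symm, h, h.not_gt, mul_comm, sgn_mul_self, sgn_zero,
            ← Int.cast_mul]
        · simp [hr, hs, hrs, hrs.symm, h, h.not_gt, sgn_zero]
      · simp [hL]
    · simp [hs, hrs.symm]
  · simp [hr, hrs]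

/-! ### Homogeneous elements -/

/-- `M` is homogeneous of parity `x`. -/
def IsHomog [Ring A] [ParityRing A] (x : ZMod 2) (M : AuxMat p N A) : Prop :=
  ∀ I J, ParityRing.gr (M I J) = sgn (deg p I J + x) • M I J

theorem IsHomog.mul [Ring A] [ParityRing A] {x y : ZMod 2} {M M' : AuxMat p N A}
    (h : IsHomog x M) (h' : IsHomog y M') : IsHomog (x + y) (M * M') := by
  intro I L
  rw [mul_apply, map_sum, Finset.smul_sum]
  refine Finset.sum_congr rfl fun J _ => ?_
  rw [map_zsmul, map_mul, grPow_of_homogeneous (h I J), map_zsmul, h I J, h' J L,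
    ← deg_add I J L]
  simp only [smul_mul_assoc, mul_smul_comm, smul_smul, sgn_add]
  congr 1
  ring

theorem IsHomog.one [Ring A] [ParityRing A] : IsHomog 0 (1 : AuxMat p N A) := by
  intro I J
  rw [one_apply]
  split_ifs with h
  · simp [h, deg_self, sgn_zero]
  · simp

theorem IsHomog.add [Ring A] [ParityRing A] {x : ZMod 2} {M M' : AuxMat p N A}
    (h : IsHomog x M) (h' : IsHomog x M') : IsHomog x (M + M') := by
  intro I J
  rw [add_apply, map_add, h, h', smul_add]

theorem IsHomog.zsmul [Ring A] [ParityRing A] {x : ZMod 2} {M : AuxMat p N A} (k : ℤ)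
    (h : IsHomog x M) : IsHomog x (k • M) := by
  intro I J
  rw [zsmul_apply', map_zsmul, h, smul_comm]

theorem IsHomog.sum [Ring A] [ParityRing A] {x : ZMod 2} {ι : Type*} {s : Finset ι}
    {F : ι → AuxMat p N A} (h : ∀ i ∈ s, IsHomog x (F i)) : IsHomog x (∑ i ∈ s, F i) := by
  intro I J
  rw [sum_apply, map_sum, Finset.smul_sum]
  exact Finset.sum_congr rfl fun i hi => h i hi I J

theorem IsHomog.list_prod [Ring A] [ParityRing A] {l : List (AuxMat p N A)}
    (h : ∀ M ∈ l, IsHomog 0 M) : IsHomog 0 l.prod := by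
  induction l with
  | nil => exact IsHomog.one
  | cons M l ih =>
    rw [List.prod_cons, ← add_zero (0 : ZMod 2)]
    exact (h M (by simp)).mul (ih fun M' hM' => h M' (by simp [hM']))

theorem isHomog_ofEntries [Ring A] [ParityRing A] {x : ZMod 2} (r : Fin N)
    {t : Fin d → Fin d → A} (ht : ∀ i j, ParityRing.gr (t i j) = sgn (p i + p j + x) • t i j) :
    IsHomog x (ofEntries r t : AuxMat p N A) := by
  intro I J
  rw [ofEntries_apply]
  split_ifs with h
  · rw [h, deg_update, ht]; simp
  · simp

theorem isHomog_E [Ring A] [ParityRing A] (r : Fin N) (i j : Fin d) :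
    IsHomog (p i + p j) (E r i j : AuxMat p N A) := by
  rw [E_eq_ofEntries]
  refine isHomog_ofEntries r fun k l => ?_
  split_ifs with h
  · rw [h.1, h.2, CharTwo.add_self_eq_zero, sgn_zero]; simp
  · simp

/-! ### The graded transposition -/

/-- The exponent of the sign in the graded transposition of `E_{i_1 j_1} ⊗ ⋯ ⊗ E_{i_N j_N}`. -/
def tsign (p : Fin d → ZMod 2) (I J : Fin N → Fin d) : ZMod 2 :=
  ∑ q, (p (I q) * p (J q) + p (I q))

/-- The tensor product of the graded transpositions `E_{ij} ↦ (-1)^{[i][j]+[i]} E_{ji}` of the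
matrix factors and of the map `ψ` of `A`. -/
def gradedTranspose [Ring A] (ψ : A →+ A) : AuxMat p N A →+ AuxMat p N A where
  toFun M := fun I J => sgn (tsign p J I) • ψ (M J I)
  map_zero' := by ext I J; simp
  map_add' M M' := by
    ext I J
    exact (congrArg _ (map_add ψ _ _)).trans (smul_add _ _ _)

theorem gradedTranspose_apply [Ring A] (ψ : A →+ A) (M : AuxMat p N A) (I J : Fin N → Fin d) :
    gradedTranspose ψ M I J = sgn (tsign p J I) • ψ (M J I) := rfl

theorem tsign_self (I : Fin N → Fin d) : tsign p I I = 0 := by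
  refine Finset.sum_eq_zero fun q _ => ?_
  generalize p (I q) = x
  revert x; decide

/-- The product of the two total degrees is a double sum over slots. Its parts below and above the
diagonal are the two `cross` terms, and its diagonal is the failure of `tsign` to be additive along
L, J, I. -/
theorem tsign_cross (L J I : Fin N → Fin d) :
    tsign p L I + cross p L J I
      = cross p I J L + deg p L J * deg p J I + tsign p J I + tsign p L J := by
  -- A product of two sums, split into the pairs with `q < r`, `q > r` and `q = r`.
  have e : ∀ D D' : Fin N → ZMod 2, (∑ r, ∑ q, if q < r then D r * D' q else 0)
      + (∑ r, ∑ q, if q < r then D' r * D q else 0) + ∑ q, D q * D' q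
      = (∑ q, D q) * ∑ q, D' q := by
    intro D D'
    have h1 : (∑ r, ∑ q, if q < r then D' r * D q else 0)
        = ∑ r, ∑ q, if r < q then D r * D' q else 0 := by
      rw [Finset.sum_comm]
      simp only [mul_comm]
    have h2 : ∑ q, D q * D' q = ∑ r, ∑ q, if r = q then D r * D' q else 0 := by simp
    rw [h1, h2, Finset.sum_mul_sum]
    simp only [← Finset.sum_add_distrib]
    refine Finset.sum_congr rfl fun r _ => Finset.sum_congr rfl fun q _ => ?_
    rcases lt_trichotomy q r with h | h | h
    · simp [h, h.not_gt, h.ne']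
    · simp [h]
    · simp [h, h.not_gt, h.ne]
  have h1 := e (fun q => p (L q) + p (J q)) fun q => p (J q) + p (I q)
  have h2 : tsign p L I + tsign p J I + tsign p L J
      = ∑ q, (p (L q) + p (J q)) * (p (J q) + p (I q)) := by
    simp only [tsign, ← Finset.sum_add_distrib]
    refine Finset.sum_congr rfl fun q _ => ?_
    generalize p (L q) = x, p (J q) = y, p (I q) = z
    revert x y z; decide
  have h3 : cross p I J L = ∑ r, ∑ q, if q < r then
      (p (J r) + p (I r)) * (p (L q) + p (J q)) else 0 := by
    simp only [cross, add_comm]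
  rw [← h2, ← h3] at h1
  change cross p L J I + _ + _ = deg p L J * deg p J I at h1
  rw [← h1]
  generalize tsign p L I = x1, tsign p J I = x2, tsign p L J = x3, cross p L J I = x4,
    cross p I J L = x5
  revert x1 x2 x3 x4 x5
  decide

/-- Homogeneity of M and M' makes all their entries homogeneous, so the sign rule for ψ applies
entry by entry. The signs from ψ, from the matrix factors and from the passage of coefficients
through matrices then balance by `tsign_cross`. -/
theorem gradedTranspose_mul [Ring A] [ParityRing A] {ψ : A →+ A}
    (hgr : ∀ y, ParityRing.gr (ψ y) = ψ (ParityRing.gr y))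
    (hψ : ∀ (x y : ZMod 2) (a b : A), ParityRing.gr a = sgn x • a → ParityRing.gr b = sgn y • b →
      ψ (a * b) = sgn (x * y) • (ψ b * ψ a))
    {x y : ZMod 2} {M M' : AuxMat p N A} (h : IsHomog x M) (h' : IsHomog y M') :
    gradedTranspose ψ (M * M')
      = sgn (x * y) • (gradedTranspose ψ M' * gradedTranspose ψ M) := by
  ext I L
  rw [gradedTranspose_apply, zsmul_apply', mul_apply, mul_apply, map_sum, Finset.smul_sum,
    Finset.smul_sum]
  refine Finset.sum_congr rfl fun J _ => ?_
  have h2 : ParityRing.gr (ψ (M' J I)) = sgn (deg p J I + y) • ψ (M' J I) := by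
    rw [hgr, h', map_zsmul]
  rw [map_zsmul, grPow_of_homogeneous (h L J), smul_mul_assoc, map_zsmul,
    hψ _ _ _ _ (h L J) (h' J I), gradedTranspose_apply, gradedTranspose_apply, map_zsmul,
    grPow_of_homogeneous h2, smul_mul_smul_comm, smul_mul_assoc]
  simp only [smul_smul, ← sgn_add]
  congr 2
  have e := tsign_cross (p := p) L J I
  have e2 : deg p J L = deg p L J := by simp only [deg, add_comm]
  rw [e2]
  generalize deg p L J = d1, deg p J I = d2, tsign p L I = x1, tsign p J I = x2,
    tsign p L J = x3, cross p L J I = x4, cross p I J L = x5 at *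
  -- The terms `d1 * d2` and `d2 * x` left over after `tsign_cross` occur twice.
  have h0 : (2 : ZMod 2) = 0 := rfl
  linear_combination e + (d1 * d2 + d2 * x) * h0

theorem str_gradedTranspose [Ring A] (ψ : A →+ A) (M : AuxMat p N A) :
    (gradedTranspose ψ M).str = ψ M.str := by
  simp only [str, gradedTranspose_apply, tsign_self, sgn_zero, one_smul, map_sum, map_zsmul]

theorem gradedTranspose_ofEntries [Ring A] (ψ : A →+ A) (r : Fin N) (t : Fin d → Fin d → A) :
    gradedTranspose ψ (ofEntries r t : AuxMat p N A)
      = ofEntries r fun i j => sgn (p j * p i + p j) • ψ (t j i) := by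
  ext I J
  have e : I = Function.update J r (I r) ↔ J = Function.update I r (J r) := by
    constructor <;> intro h
    · rw [h]; simp
    · rw [h]; simp
  rw [gradedTranspose_apply, ofEntries_apply, ofEntries_apply]
  by_cases h : J = Function.update I r (J r)
  · rw [if_pos h, if_pos (e.2 h)]
    congr 2
    rw [tsign, Finset.sum_eq_single r]
    · intro q _ hq
      rw [h]
      simp only [Function.update_of_ne hq]
      generalize p (I q) = x
      revert x; decide
    · simp
  · rw [if_neg h, if_neg (fun h' => h (e.1 h'))]
    simp

theorem gradedTranspose_E [Ring A] {ψ : A →+ A} (h1 : ψ 1 = 1) (r : Fin N) (i j : Fin d) :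
    gradedTranspose ψ (E r i j : AuxMat p N A) = sgn (p i * p j + p i) • E r j i := by
  rw [E_eq_ofEntries, gradedTranspose_ofEntries, E_eq_ofEntries]
  ext I J
  rw [zsmul_apply, ofEntries_apply, ofEntries_apply]
  split_ifs with h2 h3 h4 h4
  · simp [h3.1, h3.2, h1]
  · exact absurd ⟨h3.2, h3.1⟩ h4
  · exact absurd ⟨h4.2, h4.1⟩ h3
  · simp
  · simp

/-! ### Permutations of the matrix factors -/

/-- The exponent of the sign in the permutation of `E_{i_1 j_1} ⊗ ⋯ ⊗ E_{i_N j_N}` by `π`. -/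
def invSign (p : Fin d → ZMod 2) (π : Equiv.Perm (Fin N)) (I J : Fin N → Fin d) : ZMod 2 :=
  ∑ r, ∑ q, if q < r ∧ π r < π q then
    (p (I (π r)) + p (J (π r))) * (p (I (π q)) + p (J (π q))) else 0

/-- Folds a double sum onto the pairs `q < r`, so that sums ordered by `π q < π r` can be compared
termwise with sums ordered by `q < r`. -/
theorem sum_sum_eq_sum_lt {F : Fin N → Fin N → ZMod 2} (hF : ∀ r, F r r = 0) :
    ∑ r, ∑ q, F r q = ∑ r, ∑ q, if q < r then F r q + F q r else 0 := by
  have h1 : ∑ r, ∑ q, F r q = (∑ r, ∑ q, if q < r then F r q else 0)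
      + ∑ r, ∑ q, if r < q then F r q else 0 := by
    simp only [← Finset.sum_add_distrib]
    refine Finset.sum_congr rfl fun r _ => Finset.sum_congr rfl fun q _ => ?_
    rcases lt_trichotomy q r with h | h | h
    · simp [h, h.not_gt]
    · simp [h, hF]
    · simp [h, h.not_gt]
  rw [h1, Finset.sum_comm (f := fun r q => if r < q then F r q else 0)]
  simp only [← Finset.sum_add_distrib]
  refine Finset.sum_congr rfl fun r _ => Finset.sum_congr rfl fun q _ => ?_
  split_ifs <;> simp

/-- The cocycles `cross` before and after the permutation differ by the coboundary of `invSign`;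
this is what makes `permHom` multiplicative. Only the pairs inverted by π contribute to the
difference. -/
theorem invSign_cross (π : Equiv.Perm (Fin N)) (I J L : Fin N → Fin d) :
    invSign p π I J + invSign p π J L + cross p I J L
      = invSign p π I L + cross p (I ∘ π) (J ∘ π) (L ∘ π) := by
  have h1 : cross p I J L = ∑ r, ∑ q, if π q < π r then
      (p (I (π r)) + p (J (π r))) * (p (J (π q)) + p (L (π q))) else 0 := by
    rw [cross, ← Equiv.sum_comp π]
    exact Finset.sum_congr rfl fun r _ => (Equiv.sum_comp π _).symm
  rw [h1, sum_sum_eq_sum_lt (by simp)]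
  simp only [invSign, cross, ← Finset.sum_add_distrib, Function.comp_apply]
  refine Finset.sum_congr rfl fun r _ => Finset.sum_congr rfl fun q _ => ?_
  generalize p (I (π r)) = x, p (J (π r)) = y, p (L (π r)) = z,
    p (I (π q)) = x', p (J (π q)) = y', p (L (π q)) = z'
  by_cases h : q < r
  · have hne : π q ≠ π r := fun e => h.ne (π.injective e)
    rcases lt_or_gt_of_ne hne with h' | h'
    · simp [h, h', h'.not_gt]
    · simp only [h, h', h'.not_gt, and_self, if_true, if_false]
      revert x y z x' y' z'; decide
  · simp [h]

theorem deg_comp (π : Equiv.Perm (Fin N)) (I J : Fin N → Fin d) :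
    deg p (I ∘ π) (J ∘ π) = deg p I J :=
  Equiv.sum_comp π fun q => p (I q) + p (J q)

/-- Precomposition of multi-indices with a permutation. -/
def permIndex (d : ℕ) (π : Equiv.Perm (Fin N)) : (Fin N → Fin d) ≃ (Fin N → Fin d) :=
  Equiv.arrowCongr π.symm (Equiv.refl _)

theorem permIndex_apply (π : Equiv.Perm (Fin N)) (I : Fin N → Fin d) :
    permIndex d π I = I ∘ π := rfl

theorem invSign_self (π : Equiv.Perm (Fin N)) (I : Fin N → Fin d) : invSign p π I I = 0 := by
  simp [invSign, CharTwo.add_self_eq_zero]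

/-- The automorphism of the graded tensor product that moves the `r`-th matrix factor to the place
`π r`. -/
def permHom [Ring A] [ParityRing A] (π : Equiv.Perm (Fin N)) : AuxMat p N A →+* AuxMat p N A where
  toFun M := fun I J => sgn (invSign p π I J) • M (I ∘ π) (J ∘ π)
  map_zero' := by ext I J; simp
  map_add' M M' := by
    ext I J
    exact smul_add _ _ _
  map_one' := by
    ext I J
    rw [one_apply, one_apply]
    have e : I ∘ π = J ∘ π ↔ I = J := (permIndex d π).injective.eq_iff
    by_cases h : I = J
    · simp [h, invSign_self, sgn_zero]
    · simp [h, e]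
  map_mul' M M' := by
    ext I L
    refine Eq.trans ?_ (mul_apply _ _ I L).symm
    rw [mul_apply, Finset.smul_sum, ← (permIndex d π).sum_comp]
    refine Finset.sum_congr rfl fun J _ => ?_
    rw [permIndex_apply, map_zsmul, smul_mul_smul_comm, smul_smul, smul_smul, deg_comp,
      ← sgn_add, ← sgn_add, ← sgn_add, ← invSign_cross]
    congr 2
    ring

theorem permHom_apply [Ring A] [ParityRing A] (π : Equiv.Perm (Fin N)) (M : AuxMat p N A)
    (I J : Fin N → Fin d) :
    permHom π M I J = sgn (invSign p π I J) • M (I ∘ π) (J ∘ π) := rfl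

theorem str_permHom [Ring A] [ParityRing A] (π : Equiv.Perm (Fin N)) (M : AuxMat p N A) :
    (permHom π M).str = M.str := by
  rw [str, str, ← (permIndex d π).sum_comp fun I => sgn (∑ r, p (I r)) • M I I]
  refine Finset.sum_congr rfl fun I _ => ?_
  rw [permHom_apply, invSign_self, sgn_zero, one_smul, permIndex_apply]
  congr 2
  exact (Equiv.sum_comp π fun q => p (I q)).symm

/-- No sign appears: only one tensor slot carries a nontrivial degree, whereas `invSign` multiplies
the degrees of two distinct slots. -/
theorem permHom_ofEntries [Ring A] [ParityRing A] (π : Equiv.Perm (Fin N)) (r : Fin N)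
    (t : Fin d → Fin d → A) :
    permHom π (ofEntries r t : AuxMat p N A) = ofEntries (π r) t := by
  ext I J
  rw [permHom_apply, ofEntries_apply, ofEntries_apply]
  have e : J ∘ π = Function.update (I ∘ π) r ((J ∘ π) r)
      ↔ J = Function.update I (π r) (J (π r)) := by
    rw [Function.comp_apply, ← Function.update_comp_eq_of_injective _ π.injective]
    exact (permIndex d π).injective.eq_iff (a := J) (b := Function.update I (π r) (J (π r)))
  by_cases h : J = Function.update I (π r) (J (π r))
  · rw [if_pos h, if_pos (e.2 h)]
    rw [invSign, Finset.sum_eq_zero, sgn_zero, one_smul]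
    · rfl
    · intro s _
      refine Finset.sum_eq_zero fun q _ => ?_
      split_ifs with hq
      · by_cases hs : s = r
        · have : π q ≠ π r := fun h => hq.1.ne (π.injective h |>.trans hs.symm)
          rw [h]
          simp [this, CharTwo.add_self_eq_zero]
        · have : π s ≠ π r := fun h => hs (π.injective h)
          rw [h]
          simp [this, CharTwo.add_self_eq_zero]
      · rfl
  · rw [if_neg h, if_neg (fun h' => h (e.1 h')), smul_zero]

theorem permHom_E [Ring A] [ParityRing A] (π : Equiv.Perm (Fin N)) (r : Fin N) (i j : Fin d) :
    permHom π (E r i j : AuxMat p N A) = E (π r) i j := by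
  rw [E_eq_ofEntries, permHom_ofEntries, ← E_eq_ofEntries]

/-! ### Cyclicity of the super-trace -/

/-- The elements `M` whose entries are integers. -/
def integral (p : Fin d → ZMod 2) (N : ℕ) (A : Type*) [Ring A] [ParityRing A] :
    Submonoid (AuxMat p N A) where
  carrier := {M | ∀ I J, ∃ k : ℤ, M I J = k}
  one_mem' I J := ⟨if I = J then 1 else 0, by rw [one_apply]; split_ifs <;> simp⟩
  mul_mem' {M M'} h h' I L := by
    choose k hk using h
    choose k' hk' using h'
    refine ⟨∑ J, sgn (cross p I J L) * (k I J * k' J L), ?_⟩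
    rw [mul_apply]
    push_cast
    refine Finset.sum_congr rfl fun J _ => ?_
    rw [hk, hk', map_intCast, zsmul_eq_mul]

theorem E_mem_integral [Ring A] [ParityRing A] (r : Fin N) (i j : Fin d) :
    E r i j ∈ integral p N A := fun I J =>
  ⟨if I r = i ∧ J = Function.update I r j then 1 else 0, by rw [E_apply]; split_ifs <;> simp⟩

/-- Integer entries are central and fixed by the grading, so the coefficients of X and M can be
exchanged. Because M is even, its entry in position (J, I) has the same parity as the corresponding
matrix unit, and the resulting sign matches the change of super-trace weight from I to J. -/
theorem str_mul_comm [Ring A] [ParityRing A] {X M : AuxMat p N A} (hX : X ∈ integral p N A)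
    (hM : IsHomog 0 M) : (X * M).str = (M * X).str := by
  simp only [str, mul_apply, Finset.smul_sum]
  rw [Finset.sum_comm]
  refine Finset.sum_congr rfl fun J _ => Finset.sum_congr rfl fun I _ => ?_
  obtain ⟨k, hk⟩ := hX I J
  rw [hk, map_intCast, grPow_of_homogeneous (hM J I), (Int.cast_commute k _).eq, smul_mul_assoc,
    smul_smul, smul_smul, smul_smul, ← sgn_add, ← sgn_add, ← sgn_add]
  congr 2
  have h1 : cross p I J I = cross p J I J := by simp only [cross, add_comm]
  have h2 : deg p I J = ∑ q, p (I q) + ∑ q, p (J q) := Finset.sum_add_distrib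
  have h3 : deg p J I = ∑ q, p (I q) + ∑ q, p (J q) := by
    rw [add_comm]; exact Finset.sum_add_distrib
  rw [h1, h2, h3]
  generalize cross p J I J = x, ∑ q, p (I q) = y, ∑ q, p (J q) = z
  revert x y z; decide

/-! ### `R`-matrices -/

/-- The graded permutation `P_{rs} = ∑_{i,j} (-1)^{[j]} E_{ij}^{(r)} E_{ji}^{(s)}`. -/
def Pmat [Ring A] [ParityRing A] (r s : Fin N) : AuxMat p N A :=
  ∑ i, ∑ j, sgn (p j) • ((E r i j : AuxMat p N A) * E s j i)

theorem Rmat_eq {K : Type*} [CommRing K] [Ring A] [ParityRing A] [Algebra K A] (r s : Fin N)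
    (g : K) : (Rmat r s g : AuxMat p N A) = 1 + g • Pmat r s := rfl

theorem mul_smul_scalar {K : Type*} [CommRing K] [Ring A] [ParityRing A] [Algebra K A] (g : K)
    (M M' : AuxMat p N A) : M * (g • M') = g • (M * M') := by
  ext I L
  rw [smul_apply, mul_apply, mul_apply, Finset.smul_sum]
  refine Finset.sum_congr rfl fun J _ => ?_
  rw [smul_apply, mul_smul_comm, smul_comm]

theorem smul_scalar_mul {K : Type*} [CommRing K] [Ring A] [ParityRing A] [Algebra K A]
    (hK : ∀ (k : K) (y : A), ParityRing.gr (k • y) = k • ParityRing.gr y) (g : K)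
    (M M' : AuxMat p N A) : (g • M) * M' = g • (M * M') := by
  ext I L
  rw [smul_apply, mul_apply, mul_apply, Finset.smul_sum]
  refine Finset.sum_congr rfl fun J _ => ?_
  have : grPow (deg p J L) (g • M I J) = g • grPow (deg p J L) (M I J) := by
    unfold grPow
    split_ifs
    · rfl
    · exact hK _ _
  rw [smul_apply, this, smul_mul_assoc, smul_comm]

theorem isHomog_Pmat [Ring A] [ParityRing A] (r s : Fin N) :
    IsHomog 0 (Pmat r s : AuxMat p N A) := by
  refine IsHomog.sum fun i _ => IsHomog.sum fun j _ => IsHomog.zsmul _ ?_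
  have := (isHomog_E (p := p) (A := A) r i j).mul (isHomog_E s j i)
  rwa [add_comm (p j), CharTwo.add_self_eq_zero] at this

theorem isHomog_Rmat {K : Type*} [CommRing K] [Ring A] [ParityRing A] [Algebra K A]
    (hK : ∀ (k : K) (y : A), ParityRing.gr (k • y) = k • ParityRing.gr y) (r s : Fin N) (g : K) :
    IsHomog 0 (Rmat r s g : AuxMat p N A) := by
  rw [Rmat_eq]
  refine IsHomog.one.add fun I J => ?_
  rw [smul_apply, hK, isHomog_Pmat, smul_comm]

theorem permHom_Rmat {K : Type*} [CommRing K] [Ring A] [ParityRing A] [Algebra K A]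
    (π : Equiv.Perm (Fin N)) (r s : Fin N) (g : K) :
    permHom π (Rmat r s g : AuxMat p N A) = Rmat (π r) (π s) g := by
  have h : permHom π (g • Pmat r s : AuxMat p N A) = g • permHom π (Pmat r s) := by
    ext I J
    rw [smul_apply, permHom_apply, permHom_apply, smul_apply, smul_comm]
  rw [Rmat_eq, Rmat_eq, map_add, map_one, h]
  simp only [Pmat, map_sum, map_zsmul, map_mul, permHom_E]

/-- Transposition sends the (i, j) term of P to its (j, i) term, up to a sign that accounts exactly
for replacing `(-1)^{[j]}` by `(-1)^{[i]}`. -/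
theorem gradedTranspose_Pmat [Ring A] [ParityRing A] {ψ : A →+ A} (h1 : ψ 1 = 1)
    (hgr : ∀ y, ParityRing.gr (ψ y) = ψ (ParityRing.gr y))
    (hψ : ∀ (x y : ZMod 2) (a b : A), ParityRing.gr a = sgn x • a → ParityRing.gr b = sgn y • b →
      ψ (a * b) = sgn (x * y) • (ψ b * ψ a)) {r s : Fin N} (hrs : r ≠ s) :
    gradedTranspose ψ (Pmat r s : AuxMat p N A) = Pmat r s := by
  -- The two summations on the left are interchanged, so that the transposed (j, i) term faces the
  -- (i, j) term.
  rw [Pmat, map_sum, Finset.sum_comm' (s := Finset.univ) (t' := Finset.univ)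
    (s' := fun _ => Finset.univ) (t := fun _ => Finset.univ) (by simp)]
  refine Finset.sum_congr rfl fun i _ => ?_
  rw [map_sum]
  refine Finset.sum_congr rfl fun j _ => ?_
  rw [map_zsmul, gradedTranspose_mul hgr hψ (isHomog_E r i j) (isHomog_E s j i),
    gradedTranspose_E h1, gradedTranspose_E h1, smul_mul_smul_comm, E_mul_E_comm hrs.symm,
    smul_smul, smul_smul, smul_smul]
  simp only [← sgn_add]
  congr 2
  generalize p i = x, p j = y
  revert x y; decide

theorem gradedTranspose_one [Ring A] {ψ : A →+ A} (h1 : ψ 1 = 1) :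
    gradedTranspose ψ (1 : AuxMat p N A) = 1 := by
  ext I J
  rw [gradedTranspose_apply, one_apply, one_apply]
  by_cases h : I = J
  · rw [if_pos h, if_pos h.symm, h, tsign_self, sgn_zero, h1, one_smul]
  · rw [if_neg h, if_neg (Ne.symm h), map_zero, smul_zero]

theorem gradedTranspose_Rmat {K : Type*} [CommRing K] [Ring A] [ParityRing A] [Algebra K A]
    {ψ : A →+ A} (h1 : ψ 1 = 1) (hK : ∀ (k : K) (y : A), ψ (k • y) = k • ψ y)
    (hgr : ∀ y, ParityRing.gr (ψ y) = ψ (ParityRing.gr y))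
    (hψ : ∀ (x y : ZMod 2) (a b : A), ParityRing.gr a = sgn x • a → ParityRing.gr b = sgn y • b →
      ψ (a * b) = sgn (x * y) • (ψ b * ψ a)) {r s : Fin N} (hrs : r ≠ s) (g : K) :
    gradedTranspose ψ (Rmat r s g : AuxMat p N A) = Rmat r s g := by
  have h : gradedTranspose ψ (g • Pmat r s : AuxMat p N A)
      = g • gradedTranspose ψ (Pmat r s) := by
    ext I J
    rw [smul_apply, gradedTranspose_apply, gradedTranspose_apply, smul_apply, hK, smul_comm]
  rw [Rmat_eq, map_add, gradedTranspose_one h1, h, gradedTranspose_Pmat h1 hgr hψ hrs]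

/-- Each term of P has the form `E_{ij} E_{ji}` and is even, so the two Koszul signs cancel. -/
theorem Pmat_commute_E [Ring A] [ParityRing A] {r s l : Fin N} (hr : r ≠ l) (hs : s ≠ l)
    (k m : Fin d) : Commute (Pmat r s : AuxMat p N A) (E l k m) := by
  refine Commute.sum_left _ _ _ fun i _ => Commute.sum_left _ _ _ fun j _ => ?_
  refine Commute.smul_left ?_ _
  rw [Commute, SemiconjBy, mul_assoc, E_mul_E_comm hs, mul_smul_comm, ← mul_assoc,
    E_mul_E_comm hr, smul_mul_assoc, smul_smul, ← sgn_add, ← mul_assoc, add_comm (p j),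
    CharTwo.add_self_eq_zero, sgn_zero, one_smul]

theorem Pmat_commute_const [Ring A] [ParityRing A] (r s : Fin N) {x : ZMod 2} {y : A}
    (hy : ParityRing.gr y = sgn x • y) : Commute (Pmat r s : AuxMat p N A) (const y) := by
  refine Commute.sum_left _ _ _ fun i _ => Commute.sum_left _ _ _ fun j _ => ?_
  refine Commute.smul_left ?_ _
  rw [Commute, SemiconjBy, ← mul_assoc, const_mul_E hy, smul_mul_assoc, mul_assoc,
    mul_assoc, const_mul_E hy, mul_smul_comm, smul_smul, ← sgn_add, add_comm (p j),
    CharTwo.add_self_eq_zero, sgn_zero, one_smul]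

theorem Rmat_commute_ofEntries {K : Type*} [CommRing K] [Ring A] [ParityRing A] [Algebra K A]
    (hK : ∀ (k : K) (y : A), ParityRing.gr (k • y) = k • ParityRing.gr y) {r s l : Fin N}
    (hr : r ≠ l) (hs : s ≠ l) (g : K) {t : Fin d → Fin d → A}
    (ht : ∀ i j, ParityRing.gr (t i j) = sgn (p i + p j) • t i j) :
    Commute (Rmat r s g : AuxMat p N A) (ofEntries l t) := by
  have h : Commute (Pmat r s : AuxMat p N A) (ofEntries l t) := by
    rw [ofEntries_eq_sum]
    exact Commute.sum_right _ _ _ fun i _ => Commute.sum_right _ _ _ fun j _ =>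
      (Pmat_commute_E hr hs i j).mul_right (Pmat_commute_const r s (ht i j))
  rw [Rmat_eq]
  refine (Commute.one_left _).add_left ?_
  rw [Commute, SemiconjBy, mul_smul_scalar, smul_scalar_mul hK, h.eq]

theorem sum_swap {M : Type*} [AddCommMonoid M] (F : Fin d → Fin d → Fin d → M) :
    ∑ i, ∑ j, ∑ k, F i j k = ∑ i, ∑ j, ∑ k, F k j i := by
  rw [Finset.sum_comm]
  conv_rhs => rw [Finset.sum_comm]
  exact Finset.sum_congr rfl fun j _ => Finset.sum_comm

/-- Multiplication by P on the left exchanges the two row indices; on the right, in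
`E_mul_E_mul_Pmat`, it exchanges the two column indices. -/
theorem Pmat_mul_E_mul_E [Ring A] [ParityRing A] {r s : Fin N} (hrs : r ≠ s) (i j k l : Fin d) :
    (Pmat r s * (E r i j * E s k l) : AuxMat p N A)
      = sgn (p i + (p i + p k) * (p i + p j)) • (E r k j * E s i l) := by
  have h : ∀ x y, (E r x y * E s y x * (E r i j * E s k l) : AuxMat p N A)
      = if y = i ∧ x = k then sgn ((p x + p y) * (p i + p j)) • (E r x j * E s y l) else 0 := by
    intro x y
    rw [mul_assoc, ← mul_assoc (E s y x), E_mul_E_comm hrs.symm, smul_mul_assoc, mul_smul_comm,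
      mul_assoc, E_mul_E_same, ← mul_assoc, E_mul_E_same, add_comm (p y)]
    split_ifs <;> simp_all
  simp only [Pmat, Finset.sum_mul, smul_mul_assoc, h, ite_and]
  simp only [smul_ite, smul_zero, Finset.sum_ite_eq', Finset.mem_univ, if_true, smul_smul,
    ← sgn_add, add_comm (p k)]

theorem E_mul_E_mul_Pmat [Ring A] [ParityRing A] {r s : Fin N} (hrs : r ≠ s) (i j k l : Fin d) :
    (E r i j * E s k l * Pmat r s : AuxMat p N A)
      = sgn (p l + (p k + p l) * (p j + p l)) • (E r i l * E s k j) := by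
  have h : ∀ x y, (E r i j * E s k l * (E r x y * E s y x) : AuxMat p N A)
      = if y = l ∧ x = j then sgn ((p k + p l) * (p x + p y)) • (E r i y * E s k x) else 0 := by
    intro x y
    rw [mul_assoc, ← mul_assoc (E s k l), E_mul_E_comm hrs.symm, smul_mul_assoc, mul_smul_comm,
      mul_assoc, E_mul_E_same, ← mul_assoc, E_mul_E_same]
    split_ifs <;> simp_all
  simp only [Pmat, Finset.mul_sum, mul_smul_comm, h, ite_and]
  simp only [smul_ite, smul_zero, Finset.sum_ite_eq', Finset.mem_univ, if_true, smul_smul,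
    ← sgn_add]

/-- Normal form with all matrix units to the left of the coefficients. The sign comes from moving `t
i j` past `E s k l`. -/
theorem ofEntries_mul_ofEntries [Ring A] [ParityRing A] (r s : Fin N)
    {t t' : Fin d → Fin d → A} (ht : ∀ i j, ParityRing.gr (t i j) = sgn (p i + p j) • t i j) :
    (ofEntries r t * ofEntries s t' : AuxMat p N A)
      = ∑ i, ∑ j, ∑ k, ∑ l, sgn ((p i + p j) * (p k + p l)) •
        (E r i j * E s k l * const (t i j * t' k l)) := by
  rw [ofEntries_eq_sum, ofEntries_eq_sum]
  simp only [Finset.sum_mul]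
  refine Finset.sum_congr rfl fun i _ => Finset.sum_congr rfl fun j _ => ?_
  simp only [Finset.mul_sum]
  refine Finset.sum_congr rfl fun k _ => Finset.sum_congr rfl fun l _ => ?_
  rw [mul_assoc, ← mul_assoc (const _), const_mul_E (ht i j), smul_mul_assoc, mul_smul_comm,
    mul_assoc (E s k l), const_mul_const, mul_assoc]

/-- The `RTT` relation. -/
theorem Rmat_mul_ofEntries_mul_ofEntries {K : Type*} [CommRing K] [Ring A] [ParityRing A]
    [Algebra K A] (hK : ∀ (k : K) (y : A), ParityRing.gr (k • y) = k • ParityRing.gr y)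
    {r s : Fin N} (hrs : r ≠ s) (g : K) {t t' : Fin d → Fin d → A}
    (ht : ∀ i j, ParityRing.gr (t i j) = sgn (p i + p j) • t i j)
    (ht' : ∀ i j, ParityRing.gr (t' i j) = sgn (p i + p j) • t' i j)
    (h : ∀ i j k l, t' k l * t i j - sgn ((p k + p l) * (p i + p j)) • (t i j * t' k l)
      = -(g • sgn (p j * (p k + p l) + p k * p l) • (t' k j * t i l - t k j * t' i l))) :
    (Rmat r s g * (ofEntries r t * ofEntries s t') : AuxMat p N A)
      = ofEntries s t' * ofEntries r t * Rmat r s g := by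
  have e1 := ofEntries_mul_ofEntries (p := p) r s (t' := t') ht
  have e2 : (ofEntries s t' * ofEntries r t : AuxMat p N A)
      = ∑ i, ∑ j, ∑ k, ∑ l, E r i j * E s k l * const (t' k l * t i j) := by
    rw [ofEntries_mul_ofEntries s r ht']
    have : ∀ F : Fin d → Fin d → Fin d → Fin d → AuxMat p N A,
        ∑ i, ∑ j, ∑ k, ∑ l, F i j k l = ∑ k, ∑ l, ∑ i, ∑ j, F i j k l := fun F => by
      rw [sum_swap, Finset.sum_comm]
      refine (Finset.sum_comm.trans (Finset.sum_congr rfl fun k _ => ?_))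
      rw [sum_swap]
    rw [this]
    refine Finset.sum_congr rfl fun i _ => Finset.sum_congr rfl fun j _ =>
      Finset.sum_congr rfl fun k _ => Finset.sum_congr rfl fun l _ => ?_
    rw [E_mul_E_comm hrs, smul_mul_assoc, mul_comm (p i + p j)]
  have e3 : (Pmat r s * (ofEntries r t * ofEntries s t') : AuxMat p N A)
      = ∑ i, ∑ j, ∑ k, ∑ l, sgn (p k + (p k + p i) * (p k + p j) + (p k + p j) * (p i + p l)) •
        (E r i j * E s k l * const (t k j * t' i l)) := by
    -- P exchanges the row indices i and k, so the summation indices are renamed accordingly before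
    -- comparing terms.
    rw [e1, sum_swap]
    simp only [Finset.mul_sum]
    refine Finset.sum_congr rfl fun i _ => Finset.sum_congr rfl fun j _ =>
      Finset.sum_congr rfl fun k _ => Finset.sum_congr rfl fun l _ => ?_
    rw [mul_smul_comm, ← mul_assoc, Pmat_mul_E_mul_E hrs, smul_mul_assoc, smul_smul, ← sgn_add,
      add_comm (_ * (p i + p l))]
  have e4 : (ofEntries s t' * ofEntries r t * Pmat r s : AuxMat p N A)
      = ∑ i, ∑ j, ∑ k, ∑ l, sgn (p j + (p k + p j) * (p l + p j)) •
        (E r i j * E s k l * const (t' k j * t i l)) := by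
    rw [e2]
    simp only [Finset.sum_mul]
    refine Finset.sum_congr rfl fun i _ => ?_
    rw [sum_swap]
    refine Finset.sum_congr rfl fun j _ =>
      Finset.sum_congr rfl fun k _ => Finset.sum_congr rfl fun l _ => ?_
    have hh : ParityRing.gr (t' k j * t i l) = sgn ((p k + p j) + (p i + p l)) • (t' k j * t i l) := by
      rw [map_mul, ht, ht', smul_mul_smul_comm, ← sgn_add]
    -- P commutes with the homogeneous coefficient, hence can act on the matrix units directly.
    rw [mul_assoc, ← (Pmat_commute_const r s hh).eq, ← mul_assoc, E_mul_E_mul_Pmat hrs,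
      smul_mul_assoc]
  rw [Rmat_eq, add_mul, one_mul, mul_add, mul_one, mul_smul_scalar, smul_scalar_mul hK, e3, e4,
    e1, e2]
  simp only [Finset.smul_sum, ← Finset.sum_add_distrib]
  refine Finset.sum_congr rfl fun i _ => Finset.sum_congr rfl fun j _ =>
    Finset.sum_congr rfl fun k _ => Finset.sum_congr rfl fun l _ => ?_
  have hc : ∀ (n : ℤ) (z : A), (n • (E r i j * E s k l * const z) : AuxMat p N A)
      = E r i j * E s k l * const (n • z) := fun n z => by rw [const_zsmul, mul_smul_comm]
  have hg : ∀ (z : A), (g • (E r i j * E s k l * const z) : AuxMat p N A)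
      = E r i j * E s k l * const (g • z) := fun z => by
    ext I J
    rw [smul_apply, mul_const_apply, mul_const_apply, mul_smul_comm]
  simp only [hc, hg, ← mul_add, ← const_add]
  congr 2
  have h' := h i j k l
  have s1 := sgn_mul_self ((p i + p j) * (p k + p l))
  -- The signs produced by the two actions of P both reduce to the sign of the defining relation; in
  -- `s3` the dependence on `p i` drops out.
  have s2 : sgn (p j + (p k + p j) * (p l + p j)) = sgn (p j * (p k + p l) + p k * p l) := by
    generalize p j = x, p k = y, p l = z
    revert x y z; decide
  have s3 : sgn (p k + (p k + p i) * (p k + p j) + (p k + p j) * (p i + p l))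
      = sgn (p j * (p k + p l) + p k * p l) := by
    generalize p i = w, p j = x, p k = y, p l = z
    revert w x y z; decide
  rw [mul_comm (p k + p l)] at h'
  rw [s2, s3]
  rw [sub_eq_iff_eq_add] at h'
  rw [h', smul_sub, smul_sub]
  abel

end AuxMat

/-! ### The transposition of series -/

theorem exists_even_add_odd (m n : ℕ) (y : Yangian m n) :
    ∃ y₀ y₁, gr m n y₀ = y₀ ∧ gr m n y₁ = -y₁ ∧ y = y₀ + y₁ := by
  refine ⟨(1 / 2 : ℂ) • (y + gr m n y), (1 / 2 : ℂ) • (y - gr m n y), ?_, ?_, ?_⟩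
  · rw [map_smul, map_add, gr_gr, add_comm]
  · rw [map_smul, map_sub, gr_gr, ← smul_neg, neg_sub]
  · module

/-- A form of the graded antimorphism rule that is bilinear in y and z and needs no homogeneity. On
homogeneous arguments the four terms add up to 2, or to -2 if both are odd. Being bilinear, it
passes to coefficients of power series and then to the tensor product with rational functions, where
it can be checked on pure tensors. -/
theorem two_smul_transpose_mul (m n : ℕ) (y z : Yangian m n) :
    (2 : ℂ) • transpose m n (y * z) = transpose m n z * transpose m n y
      + transpose m n z * transpose m n (gr m n y) + transpose m n (gr m n z) * transpose m n y
      - transpose m n (gr m n z) * transpose m n (gr m n y) := by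
  obtain ⟨y₀, y₁, hy₀, hy₁, rfl⟩ := exists_even_add_odd m n y
  obtain ⟨z₀, z₁, hz₀, hz₁, rfl⟩ := exists_even_add_odd m n z
  have e0 : ∀ {w}, gr m n w = w → gr m n w = sgn 0 • w := fun h => by simpa [sgn] using h
  have e1 : ∀ {w}, gr m n w = -w → gr m n w = sgn 1 • w := fun h => by simpa [sgn] using h
  have s0 : sgn 0 = 1 := rfl
  have s1 : sgn 1 = -1 := rfl
  simp only [map_add, hy₀, hy₁, hz₀, hz₁, map_neg, add_mul, mul_add,
    transpose_mul m n _ _ _ _ (e0 hy₀) (e0 hz₀), transpose_mul m n _ _ _ _ (e0 hy₀) (e1 hz₁),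
    transpose_mul m n _ _ _ _ (e1 hy₁) (e0 hz₀), transpose_mul m n _ _ _ _ (e1 hy₁) (e1 hz₁),
    mul_zero, mul_one, s0, s1, mul_neg, neg_mul]
  module

/-- Transposition preserves parity: `T_{ij}` and `T_{ji}` have the same degree, so it suffices to
compare on generators the algebra maps obtained from `chi`. -/
theorem gr_transpose (m n : ℕ) (y : Yangian m n) :
    gr m n (transpose m n y) = transpose m n (gr m n y) := by
  have h : ∀ z, gr m n (chi m n z).unop = (chi m n (gr m n z)).unop := by
    intro z
    let θ : Yangian m n →ₐ[ℂ] (Yangian m n)ᵐᵒᵖ := (gr m n).op.comp (chi m n)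
    have : θ = (chi m n).comp (gr m n) := by
      apply algHom_ext
      intro i j r
      change MulOpposite.op (gr m n (chi m n (mode m n i j r)).unop) = chi m n (gr m n _)
      rw [chi_mode, gr_mode, map_zsmul, chi_mode, MulOpposite.unop_op, map_smul, gr_mode,
        MulOpposite.op_smul, MulOpposite.op_smul, MulOpposite.op_smul, add_comm, smul_comm]
    exact congrArg MulOpposite.unop (DFunLike.congr_fun this z)
  rw [transpose_eq, transpose_eq, h]
  simp only [map_add, map_smul]

section Series

variable {σ : Type}

/-- The transposition applied to the coefficients of a power series. -/
noncomputable def transposePowerSeries (m n : ℕ) (σ : Type) :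
    MvPowerSeries σ (Yangian m n) →ₗ[MvPolynomial σ ℂ] MvPowerSeries σ (Yangian m n) where
  toFun y e := transpose m n (MvPowerSeries.coeff e y)
  map_add' y z := by
    funext e
    exact (congrArg _ (map_add _ _ _)).trans (map_add _ _ _)
  map_smul' q y := by
    classical
    ext e
    refine Eq.trans ?_ (coeff_poly_smul m n q _ e).symm
    change transpose m n (MvPowerSeries.coeff e (q • y)) = _
    rw [coeff_poly_smul, map_sum]
    exact Finset.sum_congr rfl fun x _ => map_smul _ _ _

theorem coeff_transposePowerSeries (m n : ℕ) (y : MvPowerSeries σ (Yangian m n)) (e : σ →₀ ℕ) :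
    MvPowerSeries.coeff e (transposePowerSeries m n σ y)
      = transpose m n (MvPowerSeries.coeff e y) := rfl

theorem coeff_grPowerSeries (m n : ℕ) (y : MvPowerSeries σ (Yangian m n)) (e : σ →₀ ℕ) :
    MvPowerSeries.coeff e (grPowerSeries m n σ y) = gr m n (MvPowerSeries.coeff e y) := rfl

theorem add_transposePowerSeries_mul (m n : ℕ) (y z : MvPowerSeries σ (Yangian m n)) :
    transposePowerSeries m n σ (y * z) + transposePowerSeries m n σ (y * z) =
      transposePowerSeries m n σ z * transposePowerSeries m n σ y
      + transposePowerSeries m n σ z * transposePowerSeries m n σ (grPowerSeries m n σ y)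
      + transposePowerSeries m n σ (grPowerSeries m n σ z) * transposePowerSeries m n σ y
      - transposePowerSeries m n σ (grPowerSeries m n σ z)
        * transposePowerSeries m n σ (grPowerSeries m n σ y) := by
  classical
  ext e
  -- The Cauchy product is summed in the swapped order, because ψ exchanges the two factors.
  have hs : ∀ F G : MvPowerSeries σ (Yangian m n), MvPowerSeries.coeff e (F * G)
      = ∑ x ∈ Finset.HasAntidiagonal.antidiagonal e, MvPowerSeries.coeff x.2 F * MvPowerSeries.coeff x.1 G :=
    fun F G => (MvPowerSeries.coeff_mul _ _ _).trans
      (Finsupp.sum_antidiagonal_swap e fun x x' => MvPowerSeries.coeff x' F *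
        MvPowerSeries.coeff x G).symm
  rw [map_sub, map_add, map_add, map_add, hs, hs, hs, hs, coeff_transposePowerSeries,
    MvPowerSeries.coeff_mul, map_sum, ← Finset.sum_add_distrib, ← Finset.sum_add_distrib,
    ← Finset.sum_add_distrib, ← Finset.sum_sub_distrib]
  refine Finset.sum_congr rfl fun x _ => ?_
  simp only [coeff_transposePowerSeries, coeff_grPowerSeries, ← two_smul_transpose_mul]
  module

/-- The transposition applied to the coefficients of a series. -/
noncomputable def transposeSeries (m n : ℕ) (σ : Type) :
    YSeries m n σ →ₗ[RatFun σ] YSeries m n σ :=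
  (transposePowerSeries m n σ).baseChange (RatFun σ)

theorem gr_tmul (m n : ℕ) (k : RatFun σ) (y : MvPowerSeries σ (Yangian m n)) :
    ParityRing.gr (k ⊗ₜ y : YSeries m n σ) = k ⊗ₜ grPowerSeries m n σ y := rfl

theorem gr_smul (m n : ℕ) (k : RatFun σ) (y : YSeries m n σ) :
    ParityRing.gr (k • y) = k • ParityRing.gr y :=
  map_smul (Algebra.TensorProduct.map (AlgHom.id (RatFun σ) (RatFun σ)) (grPowerSeries m n σ)) k y

theorem transposeSeries_tmul (m n : ℕ) (k : RatFun σ) (y : MvPowerSeries σ (Yangian m n)) :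
    transposeSeries m n σ (k ⊗ₜ y) = k ⊗ₜ transposePowerSeries m n σ y := rfl

theorem transposeSeries_one (m n : ℕ) : transposeSeries m n σ 1 = 1 := by
  classical
  rw [Algebra.TensorProduct.one_def, transposeSeries_tmul]
  congr 1
  ext e
  rw [coeff_transposePowerSeries, MvPowerSeries.coeff_one]
  split_ifs
  · exact transpose_one m n
  · exact map_zero _

theorem gr_transposeSeries (m n : ℕ) (y : YSeries m n σ) :
    ParityRing.gr (transposeSeries m n σ y) = transposeSeries m n σ (ParityRing.gr y) := by
  induction y using TensorProduct.induction_on with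
  | zero => simp
  | tmul k y =>
    rw [transposeSeries_tmul, gr_tmul, gr_tmul, transposeSeries_tmul]
    congr 1
    ext e
    exact gr_transpose m n _
  | add y z hy hz => rw [map_add, map_add, map_add, map_add, hy, hz]

theorem add_transposeSeries_mul (m n : ℕ) (y z : YSeries m n σ) :
    transposeSeries m n σ (y * z) + transposeSeries m n σ (y * z) =
      transposeSeries m n σ z * transposeSeries m n σ y
      + transposeSeries m n σ z * transposeSeries m n σ (ParityRing.gr y)
      + transposeSeries m n σ (ParityRing.gr z) * transposeSeries m n σ y
      - transposeSeries m n σ (ParityRing.gr z) * transposeSeries m n σ (ParityRing.gr y) := by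
  induction y using TensorProduct.induction_on with
  | zero => simp
  | add y y' hy hy' =>
    simp only [add_mul, map_add, mul_add]
    rw [add_add_add_comm, hy, hy']
    abel
  | tmul k y =>
    induction z using TensorProduct.induction_on with
    | zero => simp
    | add z z' hz hz' =>
      simp only [add_mul, map_add, mul_add]
      rw [add_add_add_comm, hz, hz']
      abel
    | tmul k' z =>
      simp only [gr_tmul, transposeSeries_tmul, Algebra.TensorProduct.tmul_mul_tmul, mul_comm k' k,
        ← TensorProduct.tmul_add, ← TensorProduct.tmul_sub, ← add_transposePowerSeries_mul]

/-- Substituting the parities of y and z into the bilinear identity gives twice the claim, and 2 is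
invertible among the scalars. -/
theorem transposeSeries_mul (m n : ℕ) (x x' : ZMod 2) (y z : YSeries m n σ)
    (hy : ParityRing.gr y = sgn x • y) (hz : ParityRing.gr z = sgn x' • z) :
    transposeSeries m n σ (y * z)
      = sgn (x * x') • (transposeSeries m n σ z * transposeSeries m n σ y) := by
  have h := add_transposeSeries_mul m n y z
  rw [hy, hz] at h
  have h2 : (2 : RatFun σ) • transposeSeries m n σ (y * z)
      = (2 : RatFun σ) • sgn (x * x') • (transposeSeries m n σ z * transposeSeries m n σ y) := by
    rw [two_smul, two_smul, h]
    simp only [map_zsmul, mul_smul_comm, smul_mul_assoc]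
    generalize transposeSeries m n σ z * transposeSeries m n σ y = w
    rcases parity_cases x with rfl | rfl <;> rcases parity_cases x' with rfl | rfl <;>
      simp [sgn, sub_eq_add_neg]
  have h3 := congrArg (fun y => (2⁻¹ : RatFun σ) • y) h2
  simpa only [smul_smul, inv_mul_cancel₀ (two_ne_zero (α := RatFun σ)), one_smul] using h3

theorem tmul_zsmul (m n : ℕ) (k : RatFun σ) (a : ℤ) (y : MvPowerSeries σ (Yangian m n)) :
    (k ⊗ₜ (a • y) : YSeries m n σ) = a • (k ⊗ₜ y) :=
  map_zsmul (TensorProduct.mk (MvPolynomial σ ℂ) (RatFun σ) (MvPowerSeries σ (Yangian m n)) k) a y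

/-! ### The series `T_{ij}(u)` -/

theorem coeff_tSeries (m n : ℕ) (c : ℂ) (s : σ) (i j : Fin (m + n)) (e : σ →₀ ℕ)
    [Decidable (e = Finsupp.single s (e s))] :
    MvPowerSeries.coeff e (tSeries m n c s i j)
      = if e = Finsupp.single s (e s) then c ^ (e s) • mode m n i j (e s) else 0 := by
  change tSeries m n c s i j e = _
  unfold tSeries
  congr

theorem gr_tSeries (m n : ℕ) (c : ℂ) (s : σ) (i j : Fin (m + n)) :
    ParityRing.gr (1 ⊗ₜ tSeries m n c s i j : YSeries m n σ)
      = sgn (par m n i + par m n j) • (1 ⊗ₜ tSeries m n c s i j) := by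
  classical
  rw [gr_tmul, ← tmul_zsmul]
  congr 1
  ext e
  rw [coeff_grPowerSeries, map_zsmul, coeff_tSeries]
  split_ifs
  · rw [map_smul, gr_mode, smul_comm]
  · simp

theorem transposeSeries_tSeries (m n : ℕ) (c : ℂ) (s : σ) (i j : Fin (m + n)) :
    transposeSeries m n σ (1 ⊗ₜ tSeries m n c s i j : YSeries m n σ)
      = sgn (par m n i * par m n j + par m n i) • (1 ⊗ₜ tSeries m n c s j i) := by
  classical
  rw [transposeSeries_tmul, ← tmul_zsmul]
  congr 1
  ext e
  rw [coeff_transposePowerSeries, map_zsmul, coeff_tSeries, coeff_tSeries]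
  split_ifs
  · rw [map_smul, transpose_mode, smul_comm]
  · simp

/-- The coefficient of `s^{-a} t^{-b}` in the product of two series in one variable each. -/
theorem coeff_tSeries_mul_tSeries (m n : ℕ) (c : ℂ) {s t : σ} (hst : s ≠ t)
    (i j k l : Fin (m + n)) (e : σ →₀ ℕ)
    [Decidable (e = Finsupp.single s (e s) + Finsupp.single t (e t))] :
    MvPowerSeries.coeff e (tSeries m n c s i j * tSeries m n c t k l)
      = if e = Finsupp.single s (e s) + Finsupp.single t (e t) then
        c ^ (e s + e t) • (mode m n i j (e s) * mode m n k l (e t)) else 0 := by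
  classical
  rw [MvPowerSeries.coeff_mul]
  split_ifs with h
  · rw [Finset.sum_eq_single (Finsupp.single s (e s), Finsupp.single t (e t))]
    · rw [coeff_tSeries, coeff_tSeries, if_pos (by simp), if_pos (by simp)]
      rw [smul_mul_smul_comm, pow_add]
      simp
    · rintro ⟨x, y⟩ hx hne
      rw [Finset.HasAntidiagonal.mem_antidiagonal] at hx
      rw [coeff_tSeries, coeff_tSeries]
      split_ifs with h1 h2
      · exfalso
        apply hne
        simp only at hx h1 h2
        have es : e s = x s := by
          rw [← hx, Finsupp.add_apply, h2]; simp [hst.symm]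
        have et : e t = y t := by
          rw [← hx, Finsupp.add_apply, h1]; simp [hst]
        rw [es, et, ← h1, ← h2]
      all_goals simp
    · intro h'
      exact absurd (Finset.HasAntidiagonal.mem_antidiagonal.2 h.symm) h'
  · refine Finset.sum_eq_zero fun x hx => ?_
    rw [Finset.HasAntidiagonal.mem_antidiagonal] at hx
    rw [coeff_tSeries, coeff_tSeries]
    split_ifs with h1 h2
    · exfalso
      apply h
      have es : e s = x.1 s := by
        rw [← hx, Finsupp.add_apply, h2]; simp [hst.symm]
      have et : e t = x.2 t := by
        rw [← hx, Finsupp.add_apply, h1]; simp [hst]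
      rw [es, et, ← h1, ← h2, hx]
    all_goals simp

theorem coeff_X_smul [DecidableEq σ] (m n : ℕ) (s : σ) (F : MvPowerSeries σ (Yangian m n))
    (e : σ →₀ ℕ) : MvPowerSeries.coeff e ((MvPolynomial.X s : MvPolynomial σ ℂ) • F)
      = if e s = 0 then 0 else MvPowerSeries.coeff (e - Finsupp.single s 1) F := by
  have : (MvPolynomial.X s : MvPolynomial σ ℂ) • F
      = (MvPowerSeries.X s : MvPowerSeries σ (Yangian m n)) * F := by
    rw [Algebra.smul_def]
    congr 1
    change MvPowerSeries.map (algebraMap ℂ (Yangian m n))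
      (MvPolynomial.coeToMvPowerSeries.ringHom (MvPolynomial.X s : MvPolynomial σ ℂ)) = _
    simp
  rw [this, MvPowerSeries.X_def, MvPowerSeries.coeff_monomial_mul]
  simp [Finsupp.single_le_iff, Nat.one_le_iff_ne_zero, ite_not]

end Series

section Series

variable {σ : Type}

/-! ### The commutation relations of the series `T_{ij}(u)` -/

open Classical in
/-- The series `∑_{r,q} f_{rq} s^{-r} t^{-q}`. -/
noncomputable def twoVar {m n : ℕ} (s t : σ) (f : ℕ → ℕ → Yangian m n) :
    MvPowerSeries σ (Yangian m n) :=
  fun e => if e = Finsupp.single s (e s) + Finsupp.single t (e t) then f (e s) (e t) else 0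

theorem coeff_twoVar {m n : ℕ} (s t : σ) (f : ℕ → ℕ → Yangian m n) (e : σ →₀ ℕ)
    [Decidable (e = Finsupp.single s (e s) + Finsupp.single t (e t))] :
    MvPowerSeries.coeff e (twoVar s t f)
      = if e = Finsupp.single s (e s) + Finsupp.single t (e t) then f (e s) (e t) else 0 := by
  change twoVar s t f e = _
  unfold twoVar
  congr

theorem twoVar_comm {m n : ℕ} (s t : σ) (f : ℕ → ℕ → Yangian m n) :
    twoVar s t f = twoVar t s fun r q => f q r := by
  classical
  ext e
  rw [coeff_twoVar, coeff_twoVar]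
  exact if_congr (by rw [add_comm]) rfl rfl

theorem twoVar_sub {m n : ℕ} (s t : σ) (f f' : ℕ → ℕ → Yangian m n) :
    twoVar s t f - twoVar s t f' = twoVar s t fun r q => f r q - f' r q := by
  classical
  ext e
  rw [map_sub, coeff_twoVar, coeff_twoVar, coeff_twoVar]
  split_ifs <;> simp

theorem zsmul_twoVar {m n : ℕ} (s t : σ) (k : ℤ) (f : ℕ → ℕ → Yangian m n) :
    k • twoVar s t f = twoVar s t fun r q => k • f r q := by
  classical
  ext e
  rw [map_zsmul, coeff_twoVar, coeff_twoVar]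
  split_ifs <;> simp

theorem C_smul_twoVar {m n : ℕ} (s t : σ) (k : ℂ) (f : ℕ → ℕ → Yangian m n) :
    (MvPolynomial.C k : MvPolynomial σ ℂ) • twoVar s t f = twoVar s t fun r q => k • f r q := by
  classical
  ext e
  rw [coeff_poly_smul, Finset.sum_eq_single (0, e), coeff_twoVar, coeff_twoVar]
  · split_ifs <;> simp
  · rintro ⟨x, y⟩ hx hne
    rw [Finset.HasAntidiagonal.mem_antidiagonal] at hx
    rw [MvPolynomial.coeff_C, if_neg, zero_smul]
    rintro rfl
    exact hne (by simpa using hx)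
  · intro h
    exact absurd (Finset.HasAntidiagonal.mem_antidiagonal.2 (zero_add e)) h

theorem X_smul_twoVar {m n : ℕ} {s t : σ} (hst : s ≠ t) (f : ℕ → ℕ → Yangian m n) :
    (MvPolynomial.X s : MvPolynomial σ ℂ) • twoVar s t f
      = twoVar s t fun r q => if r = 0 then 0 else f (r - 1) q := by
  classical
  ext e
  rw [coeff_X_smul, coeff_twoVar, coeff_twoVar]
  by_cases hs : e s = 0
  · simp [hs]
  · rw [if_neg hs, if_neg hs]
    have e1 : (e - Finsupp.single s 1 : σ →₀ ℕ) s = e s - 1 := by simp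
    have e2 : (e - Finsupp.single s 1 : σ →₀ ℕ) t = e t := by simp [hst]
    rw [e1, e2]
    refine if_congr ?_ rfl rfl
    have e3 : e = e - Finsupp.single s 1 + Finsupp.single s 1 :=
      (tsub_add_cancel_of_le (Finsupp.single_le_iff.2 (Nat.one_le_iff_ne_zero.2 hs))).symm
    have e4 : (Finsupp.single s (e s) : σ →₀ ℕ)
        = Finsupp.single s (e s - 1) + Finsupp.single s 1 := by
      rw [← Finsupp.single_add, Nat.sub_add_cancel (Nat.one_le_iff_ne_zero.2 hs)]
    rw [e4, add_right_comm]
    constructor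
    · intro h
      rw [← h]
      exact e3
    · intro h
      exact add_right_cancel (e3.symm.trans h)

theorem tSeries_mul_tSeries {m n : ℕ} (c : ℂ) {s t : σ} (hst : s ≠ t)
    (i j k l : Fin (m + n)) : tSeries m n c s i j * tSeries m n c t k l
      = twoVar s t fun r q => c ^ (r + q) • (mode m n i j r * mode m n k l q) := by
  classical
  ext e
  rw [coeff_tSeries_mul_tSeries m n c hst, coeff_twoVar]

/-- The zeroth mode is `δ_{ij}`; it supplies the boundary coefficients of the commutation relation,
which the defining relations do not cover. -/
theorem mode_zero_comm (m n : ℕ) (i j k l : Fin (m + n)) (q : ℕ) :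
    mode m n i j 0 * mode m n k l q
      = sgn ((par m n i + par m n j) * (par m n k + par m n l)) •
        (mode m n k l q * mode m n i j 0) := by
  rw [mode_zero]
  split_ifs with h
  · rw [h, CharTwo.add_self_eq_zero, zero_mul, sgn_zero, one_smul, one_mul, mul_one]
  · simp

/-- The commutation relation with denominators cleared. Since `X s` and `X t` are the inverses of
the parameters, `g = c X_s X_t / (X_t - X_s)`, and both sides are honest power series. The
coefficient at `(r+1, q+1)` is the defining relation for the modes, and those with a zero index
follow from centrality of the zeroth modes. -/
theorem tSeries_comm (m n : ℕ) (c : ℂ) {s t : σ} (hst : s ≠ t) (i j k l : Fin (m + n)) :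
    (MvPolynomial.X t - MvPolynomial.X s : MvPolynomial σ ℂ) •
      (tSeries m n c s i j * tSeries m n c t k l
        - sgn ((par m n i + par m n j) * (par m n k + par m n l)) •
          (tSeries m n c t k l * tSeries m n c s i j))
      = (MvPolynomial.C c * MvPolynomial.X s * MvPolynomial.X t : MvPolynomial σ ℂ) •
        sgn (par m n l * (par m n i + par m n j) + par m n i * par m n j) •
          (tSeries m n c s i l * tSeries m n c t k j
            - tSeries m n c t i l * tSeries m n c s k j) := by
  have hX : ∀ f : ℕ → ℕ → Yangian m n, (MvPolynomial.X t : MvPolynomial σ ℂ) • twoVar s t f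
      = twoVar s t fun r q => if q = 0 then 0 else f r (q - 1) := fun f => by
    rw [twoVar_comm, X_smul_twoVar hst.symm, twoVar_comm]
  rw [tSeries_mul_tSeries c hst, tSeries_mul_tSeries c hst, tSeries_mul_tSeries c hst.symm,
    tSeries_mul_tSeries c hst.symm, twoVar_comm t s, twoVar_comm t s, zsmul_twoVar, twoVar_sub,
    twoVar_sub, zsmul_twoVar, sub_smul, mul_smul, mul_smul, hX, hX, X_smul_twoVar hst,
    X_smul_twoVar hst, C_smul_twoVar, twoVar_sub]
  congr 1
  funext r q
  -- If r or q is zero, the right side vanishes, and what survives on the left is a graded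
  -- commutator with a zeroth mode.
  rcases r with _ | r <;> rcases q with _ | q
  · simp
  · simp [mode_zero_comm m n i j k l, smul_comm (sgn _) (c ^ q)]
  · have h := mode_zero_comm m n k l i j (r + 1)
    have h' := mode_zero_comm m n k l i j r
    rw [mul_comm (par m n k + _)] at h h'
    simp [-zsmul_eq_mul, h', smul_comm (sgn _) (c ^ r), sgn_smul_sgn_smul]
  · have h := mode_rel m n i j k l r q
    have e1 : r + 1 + q = r + q + 1 := by omega
    have e2 : q + (r + 1) = r + q + 1 := by omega
    have e3 : r + (q + 1) = r + q + 1 := by omega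
    have e4 : q + 1 + r = r + q + 1 := by omega
    simp only [Nat.add_one_ne_zero, if_false, Nat.add_sub_cancel, e1, e2, e3, e4, add_comm q r]
    rw [smul_comm (sgn _) (c ^ (r + q + 1)), smul_comm (sgn _) (c ^ (r + q + 1)), ← smul_sub,
      ← smul_sub, ← smul_sub, h, ← smul_sub, smul_comm (sgn _) (c ^ (r + q)), smul_smul, pow_succ']

theorem gFun_antisymm (c : ℂ) (s t : σ) : gFun c s t = -gFun c t s := by
  have h : ∀ {K : Type} [Field K] (x y z : K), x / (y - z) = -(x / (z - y)) := fun x y z => by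
    rw [← neg_sub, div_neg]
  exact h _ _ _

/-- Passage from the parameters to their inverses: `1/X_s - 1/X_t = (X_t - X_s)/(X_s X_t)`. Distinct
labels keep the denominator nonzero. -/
theorem gFun_eq (c : ℂ) {s t : σ} (hst : s ≠ t) :
    gFun c s t = (algebraMap (MvPolynomial σ ℂ) (RatFun σ) (MvPolynomial.X t - MvPolynomial.X s))⁻¹
      * algebraMap (MvPolynomial σ ℂ) (RatFun σ)
        (MvPolynomial.C c * MvPolynomial.X s * MvPolynomial.X t) := by
  have hinj := IsFractionRing.injective (MvPolynomial σ ℂ) (RatFun σ)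
  have h0 : ∀ s : σ, algebraMap (MvPolynomial σ ℂ) (RatFun σ) (MvPolynomial.X s) ≠ 0 := fun s =>
    (map_ne_zero_iff _ hinj).2 (MvPolynomial.X_ne_zero s)
  have hC : algebraMap (MvPolynomial σ ℂ) (RatFun σ) (MvPolynomial.C c)
      = algebraMap ℂ (RatFun σ) c := by
    rw [IsScalarTower.algebraMap_apply ℂ (MvPolynomial σ ℂ) (RatFun σ),
      MvPolynomial.algebraMap_eq]
  have hne : algebraMap (MvPolynomial σ ℂ) (RatFun σ) (MvPolynomial.X t)
      - algebraMap (MvPolynomial σ ℂ) (RatFun σ) (MvPolynomial.X s) ≠ 0 := fun h =>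
    hst (MvPolynomial.X_injective (hinj (sub_eq_zero.1 h))).symm
  rw [gFun, param, param, map_sub, map_mul, map_mul, hC]
  have hs := h0 s
  have ht := h0 t
  generalize algebraMap (MvPolynomial σ ℂ) (RatFun σ) (MvPolynomial.X t) = x at *
  generalize algebraMap (MvPolynomial σ ℂ) (RatFun σ) (MvPolynomial.X s) = y at *
  rw [inv_sub_inv hs ht]
  field_simp

theorem tSeries_rel (m n : ℕ) (c : ℂ) {s t : σ} (hst : s ≠ t) (i j k l : Fin (m + n)) :
    ((1 ⊗ₜ tSeries m n c s i j) * (1 ⊗ₜ tSeries m n c t k l)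
        - sgn ((par m n i + par m n j) * (par m n k + par m n l)) •
          ((1 ⊗ₜ tSeries m n c t k l) * (1 ⊗ₜ tSeries m n c s i j)) : YSeries m n σ)
      = gFun c s t • sgn (par m n l * (par m n i + par m n j) + par m n i * par m n j) •
          ((1 ⊗ₜ tSeries m n c s i l) * (1 ⊗ₜ tSeries m n c t k j)
            - (1 ⊗ₜ tSeries m n c t i l) * (1 ⊗ₜ tSeries m n c s k j)) := by
  have h := congrArg (fun y => (1 ⊗ₜ y : YSeries m n σ)) (tSeries_comm m n c hst i j k l)
  have hne : algebraMap (MvPolynomial σ ℂ) (RatFun σ)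
      (MvPolynomial.X t - MvPolynomial.X s) ≠ 0 := by
    rw [map_ne_zero_iff _ (IsFractionRing.injective _ _)]
    exact fun h => hst (MvPolynomial.X_injective (sub_eq_zero.1 h)).symm
  have hq : ∀ (q : MvPolynomial σ ℂ) (y : MvPowerSeries σ (Yangian m n)),
      (1 ⊗ₜ (q • y) : YSeries m n σ) = algebraMap _ (RatFun σ) q • (1 ⊗ₜ y) := fun q y => by
    rw [TensorProduct.smul_tmul', TensorProduct.tmul_smul, TensorProduct.smul_tmul',
      Algebra.smul_def, smul_eq_mul]
  simp only [hq] at h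
  have h2 := congrArg (fun y => (algebraMap (MvPolynomial σ ℂ) (RatFun σ)
      (MvPolynomial.X t - MvPolynomial.X s))⁻¹ • y) h
  simp only [smul_smul, inv_mul_cancel₀ hne, one_smul, ← gFun_eq c hst] at h2
  simp only [Algebra.TensorProduct.tmul_mul_tmul, mul_one, ← TensorProduct.tmul_sub,
    ← tmul_zsmul]
  exact h2

end Series

/-! ### Products of `R`-matrices -/

/-- The train argument for one v-space: each `r k` carries y past its own `x k` and commutes with
all the others. The order of the r's is opposite to that of the x's, so that the r needed next
always stands beside y. -/
theorem reverse_prod_mul_mul_prod {M ι : Type*} [Monoid M] {l : List ι} (hl : l.Nodup)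
    {r x : ι → M} {y : M} (h : ∀ k, r k * (y * x k) = x k * y * r k)
    (hc : ∀ k k', k ≠ k' → Commute (r k) (x k')) :
    (l.reverse.map r).prod * (y * (l.map x).prod)
      = (l.map x).prod * y * (l.reverse.map r).prod := by
  induction l with
  | nil => simp
  | cons k l ih =>
    rw [List.nodup_cons] at hl
    have h1 : Commute (r k) (l.map x).prod := Commute.list_prod_right _ _ fun z hz => by
      obtain ⟨k', hk', rfl⟩ := List.mem_map.1 hz
      exact hc k k' fun e => hl.1 (e ▸ hk')
    have h2 : Commute (l.reverse.map r).prod (x k) := Commute.list_prod_left _ _ fun z hz => by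
      obtain ⟨k', hk', rfl⟩ := List.mem_map.1 hz
      exact hc k' k fun e => hl.1 (e ▸ List.mem_reverse.1 hk')
    simp only [List.reverse_cons, List.map_append, List.prod_append, List.map_cons, List.map_nil,
      List.prod_cons, List.prod_nil, mul_one]
    calc (l.reverse.map r).prod * r k * (y * (x k * (l.map x).prod))
        = (l.reverse.map r).prod * (r k * (y * x k)) * (l.map x).prod := by simp only [mul_assoc]
      _ = ((l.reverse.map r).prod * x k) * y * (r k * (l.map x).prod) := by
          rw [h]; simp only [mul_assoc]
      _ = x k * ((l.reverse.map r).prod * (y * (l.map x).prod)) * r k := by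
          rw [h1.eq, h2.eq]; simp only [mul_assoc]
      _ = _ := by rw [ih hl.2]; simp only [mul_assoc]

/-- The same argument one level up: x is the whole u-block, and each `w j` is a row of R-matrices
that exchanges `y j` with x. The rows commute with the other y's, which act on different spaces. -/
theorem prod_mul_prod_mul {M ι : Type*} [Monoid M] {l : List ι} (hl : l.Nodup)
    {w y : ι → M} {x : M} (h : ∀ j, w j * (y j * x) = x * y j * w j)
    (hc : ∀ j j', j ≠ j' → Commute (w j) (y j')) :
    (l.map w).prod * ((l.map y).prod * x) = x * (l.map y).prod * (l.map w).prod := by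
  induction l with
  | nil => simp
  | cons j l ih =>
    rw [List.nodup_cons] at hl
    have h1 : Commute (w j) (l.map y).prod := Commute.list_prod_right _ _ fun z hz => by
      obtain ⟨j', hj', rfl⟩ := List.mem_map.1 hz
      exact hc j j' fun e => hl.1 (e ▸ hj')
    have h2 : Commute (l.map w).prod (y j) := Commute.list_prod_left _ _ fun z hz => by
      obtain ⟨j', hj', rfl⟩ := List.mem_map.1 hz
      exact hc j' j fun e => hl.1 (e ▸ hj')
    simp only [List.map_cons, List.prod_cons]
    calc w j * (l.map w).prod * (y j * (l.map y).prod * x)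
        = w j * ((l.map w).prod * y j) * ((l.map y).prod * x) := by simp only [mul_assoc]
      _ = w j * y j * ((l.map w).prod * ((l.map y).prod * x)) := by
          rw [h2.eq]; simp only [mul_assoc]
      _ = w j * (y j * x) * (l.map y).prod * (l.map w).prod := by
          rw [ih hl.2]; simp only [mul_assoc]
      _ = x * y j * (w j * (l.map y).prod) * (l.map w).prod := by
          rw [h]; simp only [mul_assoc]
      _ = _ := by rw [h1.eq]; simp only [mul_assoc]

/-! ### Graded transposition of products -/

namespace AuxMat

variable {d : ℕ} {p : Fin d → ZMod 2} {N : ℕ} {A : Type*}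

theorem gradedTranspose_list_prod [Ring A] [ParityRing A] {ψ : A →+ A} (h1 : ψ 1 = 1)
    (hgr : ∀ y, ParityRing.gr (ψ y) = ψ (ParityRing.gr y))
    (hψ : ∀ (x y : ZMod 2) (a b : A), ParityRing.gr a = sgn x • a → ParityRing.gr b = sgn y • b →
      ψ (a * b) = sgn (x * y) • (ψ b * ψ a)) {ι : Type*} (l : List ι) {F : ι → AuxMat p N A}
    (hl : ∀ k, IsHomog 0 (F k)) :
    gradedTranspose ψ (l.map F).prod = (l.reverse.map fun k => gradedTranspose ψ (F k)).prod := by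
  induction l with
  | nil => exact gradedTranspose_one h1
  | cons k l ih =>
    rw [List.map_cons, List.prod_cons, gradedTranspose_mul hgr hψ (hl k)
      (IsHomog.list_prod fun M hM => by obtain ⟨k', -, rfl⟩ := List.mem_map.1 hM; exact hl k'), ih]
    simp [sgn_zero]

theorem sgn_mul_nsmul (x : ZMod 2) (n : ℕ) : sgn (x * n • x) = sgn x ^ n := by
  induction n with
  | zero => simp [sgn_zero]
  | succ n ih =>
    rw [succ_nsmul, mul_add, sgn_add, ih, pow_succ]
    congr 2
    clear ih
    revert x; decide

theorem isHomog_list_prod_E [Ring A] [ParityRing A] (i j : Fin d) (l : List (Fin N)) :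
    IsHomog (l.length • (p i + p j)) (l.map fun r => (E r i j : AuxMat p N A)).prod := by
  induction l with
  | nil => simpa using IsHomog.one
  | cons r l ih =>
    rw [List.map_cons, List.prod_cons, List.length_cons, succ_nsmul']
    exact (isHomog_E r i j).mul ih

/-- Each factor contributes its own transposition sign, and reversing the product contributes one
Koszul sign per pair of factors, whence the binomial exponent. -/
theorem gradedTranspose_list_prod_E [Ring A] [ParityRing A] {ψ : A →+ A} (h1 : ψ 1 = 1)
    (hgr : ∀ y, ParityRing.gr (ψ y) = ψ (ParityRing.gr y))
    (hψ : ∀ (x y : ZMod 2) (a b : A), ParityRing.gr a = sgn x • a → ParityRing.gr b = sgn y • b →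
      ψ (a * b) = sgn (x * y) • (ψ b * ψ a)) (i j : Fin d) (l : List (Fin N)) :
    gradedTranspose ψ (l.map fun r => (E r i j : AuxMat p N A)).prod
      = (sgn (p i * p j + p i) ^ l.length * sgn (p i + p j) ^ l.length.choose 2) •
        (l.reverse.map fun r => (E r j i : AuxMat p N A)).prod := by
  induction l with
  | nil => simpa using gradedTranspose_one h1
  | cons r l ih =>
    rw [List.map_cons, List.prod_cons, gradedTranspose_mul hgr hψ (isHomog_E r i j)
      (isHomog_list_prod_E i j l), ih, gradedTranspose_E h1, sgn_mul_nsmul, smul_mul_smul_comm,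
      smul_smul, List.length_cons, Nat.choose_succ_succ' l.length 1, Nat.choose_one_right]
    simp only [List.reverse_cons, List.map_append, List.prod_append, List.map_cons, List.map_nil,
      List.prod_cons, List.prod_nil, mul_one]
    congr 1
    ring

end AuxMat

/-! ### Transposition and block reversal of the factors of the Bethe vectors -/

section Series

variable {σ : Type} {m n : ℕ}

open AuxMat

/-- The transposition of series as an additive map. -/
noncomputable def transposeAddHom (m n : ℕ) (σ : Type) : YSeries m n σ →+ YSeries m n σ where
  toFun := transposeSeries m n σ
  map_zero' := map_zero _
  map_add' := map_add _

theorem transposeAddHom_apply (y : YSeries m n σ) :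
    transposeAddHom m n σ y = transposeSeries m n σ y := rfl

theorem transposeAddHom_one : transposeAddHom m n σ 1 = 1 := transposeSeries_one m n

theorem gr_transposeAddHom (y : YSeries m n σ) :
    ParityRing.gr (transposeAddHom m n σ y) = transposeAddHom m n σ (ParityRing.gr y) :=
  gr_transposeSeries m n y

theorem transposeAddHom_mul (x x' : ZMod 2) (y z : YSeries m n σ)
    (hy : ParityRing.gr y = sgn x • y) (hz : ParityRing.gr z = sgn x' • z) :
    transposeAddHom m n σ (y * z)
      = sgn (x * x') • (transposeAddHom m n σ z * transposeAddHom m n σ y) :=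
  transposeSeries_mul m n x x' y z hy hz

theorem transposeAddHom_smul (k : RatFun σ) (y : YSeries m n σ) :
    transposeAddHom m n σ (k • y) = k • transposeAddHom m n σ y :=
  map_smul (transposeSeries m n σ) k y

/-- The tensor product of the graded transpositions of the matrix factors and of `Y(m|n)`. -/
noncomputable def superTranspose (m n : ℕ) (σ : Type) (N : ℕ) :
    AuxMat (par m n) N (YSeries m n σ) →+ AuxMat (par m n) N (YSeries m n σ) :=
  gradedTranspose (transposeAddHom m n σ)

theorem superTranspose_mul {N : ℕ} {x y : ZMod 2} {M M' : AuxMat (par m n) N (YSeries m n σ)}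
    (h : IsHomog x M) (h' : IsHomog y M') : superTranspose m n σ N (M * M')
      = sgn (x * y) • (superTranspose m n σ N M' * superTranspose m n σ N M) :=
  gradedTranspose_mul gr_transposeAddHom transposeAddHom_mul h h'

theorem superTranspose_list_prod {N : ℕ} {ι : Type*} (l : List ι)
    {F : ι → AuxMat (par m n) N (YSeries m n σ)} (hl : ∀ k, IsHomog 0 (F k)) :
    superTranspose m n σ N (l.map F).prod
      = (l.reverse.map fun k => superTranspose m n σ N (F k)).prod :=
  gradedTranspose_list_prod transposeAddHom_one gr_transposeAddHom transposeAddHom_mul l hl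

theorem isHomog_Tmat (c : ℂ) {N : ℕ} (r : Fin N) (s : σ) : IsHomog 0 (Tmat m n c r s) :=
  isHomog_ofEntries r fun i j => by rw [add_zero]; exact gr_tSeries m n c s i j

/-- The sign of the matrix transposition and the sign in `ψ(T_{ij}(u))` are equal and cancel. -/
theorem superTranspose_Tmat (c : ℂ) {N : ℕ} (r : Fin N) (s : σ) :
    superTranspose m n σ N (Tmat m n c r s) = Tmat m n c r s := by
  refine (gradedTranspose_ofEntries _ r _).trans ?_
  unfold Tmat
  congr 1
  funext i j
  rw [transposeAddHom_apply, transposeSeries_tSeries, sgn_smul_sgn_smul]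

theorem superTranspose_Rmat {N : ℕ} {r s : Fin N} (hrs : r ≠ s) (g : RatFun σ) :
    superTranspose m n σ N (Rmat r s g) = Rmat r s g :=
  gradedTranspose_Rmat transposeAddHom_one transposeAddHom_smul gr_transposeAddHom
    transposeAddHom_mul hrs g

/-- The permutation of the matrix factors that reverses the order of the first `a` ones and that of
the last `b` ones. -/
def blockRev (a b : ℕ) : Equiv.Perm (Fin (a + b)) :=
  finSumFinEquiv.permCongr (Equiv.sumCongr Fin.revPerm Fin.revPerm)

theorem blockRev_castAdd (a b : ℕ) (k : Fin a) :
    blockRev a b (Fin.castAdd b k) = Fin.castAdd b k.rev := by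
  simp [blockRev, Equiv.permCongr_apply]

theorem blockRev_natAdd (a b : ℕ) (j : Fin b) :
    blockRev a b (Fin.natAdd a j) = Fin.natAdd a j.rev := by
  simp [blockRev, Equiv.permCongr_apply]

theorem castAdd_ne_natAdd {a b : ℕ} (k : Fin a) (j : Fin b) :
    Fin.castAdd b k ≠ Fin.natAdd a j := fun h => by
  have := congrArg Fin.val h
  simp at this
  omega

theorem map_reverse_finRange_rev {M : Type*} {a : ℕ} (F : Fin a → M) :
    ((List.finRange a).reverse.map fun k => F k.rev) = (List.finRange a).map F := by
  rw [List.finRange_reverse, List.map_map]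
  simp [Function.comp_def]

theorem map_finRange_rev {M : Type*} {a : ℕ} (F : Fin a → M) :
    ((List.finRange a).map fun k => F k.rev) = (List.finRange a).reverse.map F := by
  rw [List.finRange_reverse, List.map_map, Function.comp_def]

/-- Transposition reverses the whole product, while the block reversal together with the conjugated
parameters undoes this inside each block. Only the order of the two blocks stays exchanged. -/
theorem permHom_superTranspose_TT (c : ℂ) {a b : ℕ} (u : Fin a → σ) (v : Fin b → σ) :
    permHom (blockRev a b) (superTranspose m n σ (a + b) (TT m n c (conj u) (conj v)))
      = ((List.finRange b).map fun j => Tmat m n c (Fin.natAdd a j) (v j)).prod *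
        ((List.finRange a).map fun k => Tmat m n c (Fin.castAdd b k) (u k)).prod := by
  have h1 : IsHomog 0 ((List.finRange a).map fun k =>
      (Tmat m n c (Fin.castAdd b k) (conj u k) : AuxMat _ _ (YSeries m n σ))).prod :=
    IsHomog.list_prod fun M hM => by
      obtain ⟨k, -, rfl⟩ := List.mem_map.1 hM; exact isHomog_Tmat _ _ _
  have h2 : IsHomog 0 ((List.finRange b).map fun j =>
      (Tmat m n c (Fin.natAdd a j) (conj v j) : AuxMat _ _ (YSeries m n σ))).prod :=
    IsHomog.list_prod fun M hM => by
      obtain ⟨k, -, rfl⟩ := List.mem_map.1 hM; exact isHomog_Tmat _ _ _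
  rw [TT, superTranspose_mul h1 h2, superTranspose_list_prod _ fun k => isHomog_Tmat _ _ _,
    superTranspose_list_prod _ fun k => isHomog_Tmat _ _ _, mul_zero, sgn_zero, one_smul, map_mul,
    map_list_prod, map_list_prod, List.map_map, List.map_map,
    ← map_reverse_finRange_rev fun j => Tmat m n c (Fin.natAdd a j) (v j),
    ← map_reverse_finRange_rev fun k => Tmat m n c (Fin.castAdd b k) (u k)]
  have e : ∀ r s, permHom (blockRev a b) (Tmat m n c r s : AuxMat _ _ (YSeries m n σ))
      = Tmat m n c (blockRev a b r) s := fun r s => permHom_ofEntries _ _ _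
  simp only [Function.comp_def, superTranspose_Tmat, e, blockRev_castAdd, blockRev_natAdd, conj]

theorem isHomog_RR (c : ℂ) {a b : ℕ} (u : Fin a → σ) (v : Fin b → σ) :
    IsHomog 0 (RR m n c u v) := by
  refine IsHomog.list_prod fun M hM => ?_
  obtain ⟨j, -, rfl⟩ := List.mem_map.1 hM
  refine IsHomog.list_prod fun M hM => ?_
  obtain ⟨k, -, rfl⟩ := List.mem_map.1 hM
  exact isHomog_Rmat (gr_smul m n) _ _ _

theorem isHomog_TT (c : ℂ) {a b : ℕ} (u : Fin a → σ) (v : Fin b → σ) :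
    IsHomog 0 (TT m n c u v) := by
  rw [← add_zero (0 : ZMod 2)]
  refine IsHomog.mul (IsHomog.list_prod fun M hM => ?_) (IsHomog.list_prod fun M hM => ?_) <;>
  · obtain ⟨k, -, rfl⟩ := List.mem_map.1 hM
    exact isHomog_Tmat _ _ _

/-- Both products, over j and over k, are reversed by transposition and reversed back by relabelling
spaces and parameters, so ℝ is reproduced exactly. -/
theorem permHom_superTranspose_RR (c : ℂ) {a b : ℕ} (u : Fin a → σ) (v : Fin b → σ) :
    permHom (blockRev a b) (superTranspose m n σ (a + b) (RR m n c (conj u) (conj v)))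
      = RR m n c u v := by
  have e : ∀ (j : Fin b) (k : Fin a) (g : RatFun σ),
      permHom (blockRev a b) (superTranspose m n σ (a + b)
        (Rmat (Fin.natAdd a j) (Fin.castAdd b k) g))
      = Rmat (Fin.natAdd a j.rev) (Fin.castAdd b k.rev) g := fun j k g => by
    rw [superTranspose_Rmat (castAdd_ne_natAdd k j).symm, permHom_Rmat, blockRev_natAdd,
      blockRev_castAdd]
  have hR : ∀ (j : Fin b) (k : Fin a) (g : RatFun σ), IsHomog 0
      (Rmat (Fin.natAdd a j) (Fin.castAdd b k) g : AuxMat (par m n) _ (YSeries m n σ)) :=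
    fun j k g => isHomog_Rmat (gr_smul m n) _ _ _
  have hW : ∀ j : Fin b, IsHomog 0 (((List.finRange a).reverse.map fun k =>
      (Rmat (Fin.natAdd a j) (Fin.castAdd b k) (gFun c (conj v j) (conj u k)) :
        AuxMat (par m n) _ (YSeries m n σ))).prod) := fun j =>
    IsHomog.list_prod fun M hM => by
      obtain ⟨k, -, rfl⟩ := List.mem_map.1 hM; exact hR _ _ _
  rw [RR, superTranspose_list_prod _ hW, map_list_prod, List.map_map, RR, ← map_reverse_finRange_rev fun j =>
      ((List.finRange a).reverse.map fun k =>
        Rmat (Fin.natAdd a j) (Fin.castAdd b k) (gFun c (v j) (u k))).prod]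
  congr 2
  funext j
  rw [Function.comp_apply, superTranspose_list_prod _ fun k => hR _ _ _, List.reverse_reverse,
    map_list_prod, List.map_map, ← map_finRange_rev fun k =>
      Rmat (Fin.natAdd a j.rev) (Fin.castAdd b k) (gFun c (v j.rev) (u k))]
  simp only [Function.comp_def, e, conj]

/-- The sign in the transposition of `E_{ij}^{(1)} ⋯ E_{ij}^{(a)}`. -/
def blockSign (m n a : ℕ) (i j : Fin (m + n)) : ℤ :=
  sgn (par m n i * par m n j + par m n i) ^ a * sgn (par m n i + par m n j) ^ a.choose 2

theorem isHomog_EE (a b : ℕ) (i j k l : Fin (m + n)) :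
    IsHomog (a • (par m n i + par m n j) + b • (par m n k + par m n l))
      (EE m n σ a b i j k l) := by
  have h1 := isHomog_list_prod_E (p := par m n) (A := YSeries m n σ) i j
    ((List.finRange a).map (Fin.castAdd b))
  have h2 := isHomog_list_prod_E (p := par m n) (A := YSeries m n σ) k l
    ((List.finRange b).map (Fin.natAdd a))
  rw [List.map_map, List.length_map, List.length_finRange] at h1 h2
  exact h1.mul h2

/-- The hypothesis on parities says that at least one kind of matrix unit is even, so exchanging the
two blocks costs no sign and only the signs internal to the blocks remain. -/
theorem permHom_superTranspose_EE {a b : ℕ} {i j k l : Fin (m + n)}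
    (hp : (par m n i + par m n j) * (par m n k + par m n l) = 0) :
    permHom (blockRev a b) (superTranspose m n σ (a + b) (EE m n σ a b i j k l))
      = (blockSign m n a i j * blockSign m n b k l) • EE m n σ a b j i l k := by
  have h1 := isHomog_list_prod_E (p := par m n) (A := YSeries m n σ) i j
    ((List.finRange a).map (Fin.castAdd b))
  have h2 := isHomog_list_prod_E (p := par m n) (A := YSeries m n σ) k l
    ((List.finRange b).map (Fin.natAdd a))
  have e1 := gradedTranspose_list_prod_E (p := par m n) (transposeAddHom_one (σ := σ) (m := m) (n := n))
    gr_transposeAddHom transposeAddHom_mul i j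
    ((List.finRange a).map (Fin.castAdd b))
  have e2 := gradedTranspose_list_prod_E (p := par m n) (transposeAddHom_one (σ := σ) (m := m) (n := n))
    gr_transposeAddHom transposeAddHom_mul k l
    ((List.finRange b).map (Fin.natAdd a))
  rw [List.map_map, List.length_map, List.length_finRange] at h1 h2
  rw [← List.map_reverse, List.map_map, List.map_map, List.length_map,
    List.length_finRange] at e1 e2
  have hs : sgn (a • (par m n i + par m n j) * b • (par m n k + par m n l)) = 1 := by
    rw [smul_mul_smul_comm, hp, smul_zero, sgn_zero]
  have hc : Commute ((List.finRange b).map fun r => (E (Fin.natAdd a r) l k :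
      AuxMat (par m n) (a + b) (YSeries m n σ))).prod
      ((List.finRange a).map fun r => E (Fin.castAdd b r) j i).prod := by
    refine Commute.list_prod_left _ _ fun M hM => Commute.list_prod_right _ _ fun M' hM' => ?_
    obtain ⟨r, -, rfl⟩ := List.mem_map.1 hM
    obtain ⟨r', -, rfl⟩ := List.mem_map.1 hM'
    rw [Commute, SemiconjBy, E_mul_E_comm (castAdd_ne_natAdd r' r).symm, mul_comm,
      add_comm (par m n j), add_comm (par m n l), hp, sgn_zero, one_smul]
  have e3 := superTranspose_mul h1 h2
  rw [hs, one_smul] at e3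
  refine (congrArg (permHom (blockRev a b)) e3).trans ?_
  have e4 : superTranspose m n σ (a + b) _ = _ := e1
  have e5 : superTranspose m n σ (a + b) _ = _ := e2
  rw [e4, e5, map_mul, map_zsmul, map_zsmul, map_list_prod, map_list_prod, List.map_map,
    List.map_map]
  simp only [Function.comp_def, permHom_E, blockRev_castAdd, blockRev_natAdd]
  rw [map_reverse_finRange_rev fun r => (E (Fin.castAdd b r) j i :
      AuxMat (par m n) (a + b) (YSeries m n σ)),
    map_reverse_finRange_rev fun r => (E (Fin.natAdd a r) l k :
      AuxMat (par m n) (a + b) (YSeries m n σ)), smul_mul_smul_comm, hc.eq, mul_comm]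
  rfl

theorem RR_mul_TT (c : ℂ) {a b : ℕ} {u : Fin a → σ} {v : Fin b → σ} (huv : ∀ k j, u k ≠ v j) :
    RR m n c u v * (((List.finRange b).map fun j => Tmat m n c (Fin.natAdd a j) (v j)).prod *
        ((List.finRange a).map fun k => Tmat m n c (Fin.castAdd b k) (u k)).prod)
      = TT m n c u v * RR m n c u v := by
  refine prod_mul_prod_mul (List.nodup_finRange b) (fun j => ?_) (fun j j' hj => ?_)
  · refine reverse_prod_mul_mul_prod (List.nodup_finRange a) (fun k => ?_) (fun k k' hk => ?_)
    · refine Rmat_mul_ofEntries_mul_ofEntries (gr_smul m n) (castAdd_ne_natAdd k j).symm _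
        (gr_tSeries m n c _) (gr_tSeries m n c _) fun i i' l l' => ?_
      -- The relation is used with the first series at `u k`, whereas the R-matrix carries `g(v_j,
      -- u_k)`; antisymmetry of g accounts for the minus sign.
      rw [tSeries_rel m n c (huv k j) l l' i i', gFun_antisymm]
      exact neg_smul (gFun c (v j) (u k)) (_ : YSeries m n σ)
    · exact Rmat_commute_ofEntries (gr_smul m n) (castAdd_ne_natAdd k' j).symm
        (fun h => hk (Fin.castAdd_injective a b h)) _ (gr_tSeries m n c _)
  · refine Commute.list_prod_left _ _ fun M hM => ?_
    obtain ⟨k, -, rfl⟩ := List.mem_map.1 hM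
    exact Rmat_commute_ofEntries (gr_smul m n) (fun h => hj (Fin.natAdd_injective b a h))
      (castAdd_ne_natAdd k j') _ (gr_tSeries m n c _)

theorem EE_mem_integral (a b : ℕ) (i j k l : Fin (m + n)) :
    EE m n σ a b i j k l ∈ integral (par m n) (a + b) (YSeries m n σ) := by
  refine mul_mem (list_prod_mem fun M hM => ?_) (list_prod_mem fun M hM => ?_) <;>
  · obtain ⟨r, -, rfl⟩ := List.mem_map.1 hM
    exact E_mem_integral _ _ _

theorem str_zsmul {d N : ℕ} {p : Fin d → ZMod 2} {A : Type*} [Ring A] [ParityRing A] (k : ℤ)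
    (M : AuxMat p N A) : (k • M).str = k • M.str := by
  simp only [str, zsmul_apply', Finset.smul_sum]
  exact Finset.sum_congr rfl fun I _ => smul_comm _ _ _

/-- The transposition of the super-trace defining the Bethe vectors. -/
theorem transposeSeries_superTrace (c : ℂ) {a b : ℕ} {u : Fin a → σ} {v : Fin b → σ}
    (huv : ∀ k j, u k ≠ v j) {i j k l : Fin (m + n)}
    (hp : (par m n i + par m n j) * (par m n k + par m n l) = 0) :
    transposeSeries m n σ (superTrace m n c (conj u) (conj v) i j k l)
      = (blockSign m n a i j * blockSign m n b k l) • superTrace m n c u v j i l k := by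
  have hTR : IsHomog 0 (TT m n c (conj u) (conj v) * RR m n c (conj u) (conj v)) := by
    have := (isHomog_TT (m := m) (n := n) c (conj u) (conj v)).mul (isHomog_RR c (conj u) (conj v))
    rwa [add_zero] at this
  have hTR' : IsHomog 0 (TT m n c u v * RR m n c u v) := by
    have := (isHomog_TT (m := m) (n := n) c u v).mul (isHomog_RR c u v)
    rwa [add_zero] at this
  have h1 : transposeSeries m n σ (superTrace m n c (conj u) (conj v) i j k l)
      = (superTranspose m n σ (a + b) (TT m n c (conj u) (conj v) * RR m n c (conj u) (conj v)
        * EE m n σ a b i j k l)).str :=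
    (str_gradedTranspose (transposeAddHom m n σ) _).symm
  rw [h1, ← str_permHom (blockRev a b), superTranspose_mul hTR (isHomog_EE a b i j k l),
    superTranspose_mul (isHomog_TT c _ _) (isHomog_RR c _ _), zero_mul, zero_mul, sgn_zero,
    one_smul, one_smul, map_mul, map_mul, permHom_superTranspose_EE hp,
    permHom_superTranspose_RR, permHom_superTranspose_TT, RR_mul_TT c huv, smul_mul_assoc,
    str_zsmul, str_mul_comm (EE_mem_integral a b j i l k) hTR']
  rfl

/-! ### Dual Bethe vectors -/

theorem applyV_applyY {V : Type*} [AddCommGroup V] [Module ℂ V] [Module (Yangian m n) V]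
    [IsScalarTower ℂ (Yangian m n) V] {Ω : V} (h : IsHighestWeight m n Ω) (y : YSeries m n σ) :
    applyV σ (transposeVec h) (applyY σ (act m n Ω) y)
      = applyOmegaDag h (transposeSeries m n σ y) := by
  induction y using TensorProduct.induction_on with
  | zero => simp
  | tmul q y =>
    change q ⊗ₜ _ = q ⊗ₜ _
    congr 1
    funext e
    exact transposeVec_smul_eq h (MvPowerSeries.coeff e y)
  | add y z hy hz => rw [map_add, map_add, map_add, map_add, hy, hz]

theorem HFun_conj (c : ℂ) {b : ℕ} (w : Fin b → σ) :
    HFun c (conj w) = ∏ j, ∏ k, if j < k then hFun c (w j) (w k) else 1 := by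
  rw [HFun, ← Equiv.prod_comp Fin.revPerm]
  refine Finset.prod_congr rfl fun j _ => ?_
  rw [← Equiv.prod_comp Fin.revPerm]
  simp [conj]

/-- N is the size of the odd block. Its transposition sign `(-1)^N` squares away against the
normalization, leaving only the sign of the reversal; H is carried along as a scalar. -/
theorem dual_eq_of_sign {V : Type*} [AddCommGroup V] [Module ℂ V] [Module (Yangian m n) V]
    [IsScalarTower ℂ (Yangian m n) V] {Ω : V} (h : IsHighestWeight m n Ω) (c : ℂ) {a b : ℕ}
    {u : Fin a → σ} {v : Fin b → σ} (huv : ∀ k j, u k ≠ v j) {i j k l : Fin (m + n)}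
    (hp : (par m n i + par m n j) * (par m n k + par m n l) = 0) (N : ℕ) (H : RatFun σ)
    (hs : blockSign m n a i j * blockSign m n b k l = (-1) ^ N * (-1) ^ (N * (N - 1) / 2)) :
    applyV σ (transposeVec h) (((-1) ^ N / H) •
        applyY σ (act m n Ω) (superTrace m n c (conj u) (conj v) i j k l))
      = ((-1) ^ (N * (N - 1) / 2) / H) • applyOmegaDag h (superTrace m n c u v j i l k) := by
  rw [map_smul, applyV_applyY, transposeSeries_superTrace c huv hp, hs, map_zsmul,
    ← Int.cast_smul_eq_zsmul (RatFun σ), smul_smul]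
  congr 1
  push_cast
  rw [div_mul_eq_mul_div, ← mul_assoc, ← pow_add, ← two_mul, pow_mul, neg_one_sq, one_pow, one_mul]

end Series

end SuperYangian

theorem mainTheorem7 (c : ℂ) (hc : c ≠ 0) (a b : ℕ) :
    -- the generic Bethe parameters: `u_1, …, u_a` have the labels `inl`, and `v_1, …, v_b` the
    -- labels `inr`
    let u : Fin a → Fin a ⊕ Fin b := Sum.inl
    let v : Fin b → Fin a ⊕ Fin b := Sum.inr
    -- the normalizations `H(v*)` and `H(u*)`
    (SuperYangian.HFun c (SuperYangian.conj v)
        = ∏ j, ∏ k, if j < k then SuperYangian.hFun c (v j) (v k) else 1) ∧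
    (SuperYangian.HFun c (SuperYangian.conj u)
        = ∏ j, ∏ k, if j < k then SuperYangian.hFun c (u j) (u k) else 1) ∧
    -- the dual Bethe vectors of `Y(2|1)`
    (∀ (V : Type*) [AddCommGroup V] [Module ℂ V] [Module (SuperYangian.Yangian 2 1) V]
        [IsScalarTower ℂ (SuperYangian.Yangian 2 1) V] (Ω : V)
        (h : SuperYangian.IsHighestWeight 2 1 Ω),
      SuperYangian.dualBethe21 c h u v =
        ((-1) ^ (b * (b - 1) / 2) / SuperYangian.HFun c (SuperYangian.conj v)) •
          SuperYangian.applyOmegaDag h (SuperYangian.superTrace 2 1 c u v 0 1 1 2)) ∧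
    -- the dual Bethe vectors of `Y(1|2)`
    (∀ (V : Type*) [AddCommGroup V] [Module ℂ V] [Module (SuperYangian.Yangian 1 2) V]
        [IsScalarTower ℂ (SuperYangian.Yangian 1 2) V] (Ω : V)
        (h : SuperYangian.IsHighestWeight 1 2 Ω),
      SuperYangian.dualBethe12 c h u v =
        ((-1) ^ (a * (a - 1) / 2) / SuperYangian.HFun c (SuperYangian.conj u)) •
          SuperYangian.applyOmegaDag h (SuperYangian.superTrace 1 2 c u v 0 1 1 2)) := by
  intro u v
  -- The u's and v's are labelled by different summands, so every `g(v_j, u_k)` is a genuine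
  -- rational function.
  have huv : ∀ k j, u k ≠ v j := fun _ _ => Sum.inl_ne_inr
  refine ⟨SuperYangian.HFun_conj c v, SuperYangian.HFun_conj c u, ?_, ?_⟩
  · intro V _ _ _ _ Ω h
    refine SuperYangian.dual_eq_of_sign h c huv (by decide) b _ ?_
    rw [← Nat.choose_two_right]
    -- For `Y(2|1)`, `E_{21}` is even and transposes without a sign, so only the v-block, made of
    -- the odd `E_{32}`, contributes.
    have e : SuperYangian.blockSign 2 1 a 1 0 = 1 := by
      simp [SuperYangian.blockSign, SuperYangian.par, SuperYangian.sgn]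
    have e' : SuperYangian.blockSign 2 1 b 2 1 = (-1) ^ b * (-1) ^ b.choose 2 := by
      simp [SuperYangian.blockSign, SuperYangian.par, SuperYangian.sgn]
    rw [e, e', one_mul]
  · intro V _ _ _ _ Ω h
    refine SuperYangian.dual_eq_of_sign h c huv (by decide) a _ ?_
    rw [← Nat.choose_two_right]
    -- For `Y(1|2)` the roles are exchanged: `E_{21}` is odd, while `E_{32}` joins two odd indices
    -- and is even with sign `(-1)^{1+1} = 1`.
    have e : SuperYangian.blockSign 1 2 a 1 0 = (-1) ^ a * (-1) ^ a.choose 2 := by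
      simp [SuperYangian.blockSign, SuperYangian.par, SuperYangian.sgn]
    have e' : SuperYangian.blockSign 1 2 b 2 1 = 1 := by
      have h2 : (1 + 1 : ZMod 2) = 0 := rfl
      simp [SuperYangian.blockSign, SuperYangian.par, SuperYangian.sgn, h2]
    rw [e, e', mul_one]
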